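/- **Theorem 3.1.** Let $n\ge 1$ and write points of $\mathbb R^{n+1}$ as $(x,t)$ with $x\in\mathbb R^n$, $t\in\mathbb R$. For $s\in\mathbb R$ put $$\|f\|_s=\left(\int_{\mathbb R^{n+1}}|f(x,t)|^2(1+|x|^2+t^2)^s\,dx\,dt\right)^{1/2},$$ and let $L^2_s(\mathbb R^{n+1})$ be the space of (classes of) measurable complex-valued functions $f$ with $\|f\|_s<\infty$. For $z=a+ib\in\mathbb C^n$ with $a,b\in\mathbb R^n$ and $b\ne 0$, put $$P_z(\xi,\eta)=-i\eta-2i\,z\cdot\xi+|\xi|^2,\qquad z\cdot\xi=\sum_{j=1}^n z_j\xi_j,\quad(\xi,\eta)\in\mathbb R^n\times\mathbb R.$$ The function $1/P_z$ is locally integrable and defines a tempered distribution on $\mathbb R^{n+1}$. Let $G_z$ be its inverse Fourier transform, $$G_z(x,t)=\frac1{(2\pi)^{n+1}}\int e^{i(x\cdot\xi+t\eta)}\frac{d\xi\,d\eta}{P_z(\xi,\eta)}$$ (in the sense of tempered distributions), and for a rapidly decreasing (Schwartz) function $g$ let $(G_z*g)(x,t)=\langle G_z,\,g((x,t)-\cdot)\rangle$.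 Let $-1<\delta<0$ and $R>0$. There is a constant $C(R,\delta)>0$ (depending only on $R$, $\delta$ and the dimension $n$) such that for all $z=a+ib$ with $b\ne0$ and $|b|\ge R$ the following hold. 1. For every rapidly decreasing function $g$ on $\mathbb R^{n+1}$ the function $G_z*g$ is smooth, $$\|D_x^\alpha (G_z*g)\|_\delta\le C(R,\delta)\left(\sqrt{1+|a|^2}+|a|\right)|b|^{|\alpha|}\,\|g\|_{\delta+1}$$ for every multi-index $\alpha\in\mathbb{Z}_{\ge0}^n$ with $|\alpha|\le 2$, and $$\|D_t (G_z*g)\|_\delta\le C(R,\delta)\left(\sqrt{1+|a|^2}+|a|\right)\left(2|a||b|+|b|^2\right)\|g\|_{\delta+1}.$$ Here $D_x^\alpha=\partial_{x_1}^{\alpha_1}\cdots\partial_{x_n}^{\alpha_n}$ and $D_t=\partial_t$. 2. Consequently the map $g\mapsto G_z*g$, defined on rapidly decreasing functions, extends uniquely to a bounded linear operator from $L^2_{\delta+1}(\mathbb R^{n+1})$ into $L^2_\delta(\mathbb R^{n+1})$. -/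

import Mathlib

open MeasureTheory Set
open scoped ENNReal SchwartzMap FourierTransform ContDiff

namespace BackwardHeat

/-- Space-time `ℝⁿ × ℝ = ℝⁿ⁺¹` with its Euclidean structure; a point is `p = (x, t)` with
`x = p.fst`, `t = p.snd`, so that `‖p‖² = |x|² + t²`. It is also used for the dual variables
`(ξ, η)`. -/
abbrev SpaceTime (n : ℕ) : Type := WithLp 2 (EuclideanSpace ℝ (Fin n) × ℝ)

/-- The real part `a` of `z = a + ib ∈ ℂⁿ`. -/
def reVec {n : ℕ} (z : Fin n → ℂ) : EuclideanSpace ℝ (Fin n) := WithLp.toLp 2 fun j => (z j).re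

/-- The imaginary part `b` of `z = a + ib ∈ ℂⁿ`. -/
def imVec {n : ℕ} (z : Fin n → ℂ) : EuclideanSpace ℝ (Fin n) := WithLp.toLp 2 fun j => (z j).im

/-- The symbol `P_z(ξ, η) = -iη - 2i z·ξ + |ξ|²`. -/
noncomputable def symbol {n : ℕ} (z : Fin n → ℂ) (p : SpaceTime n) : ℂ :=
  -Complex.I * (p.snd : ℂ) - 2 * Complex.I * ∑ j, z j * (p.fst j : ℂ) + ((‖p.fst‖ ^ 2 : ℝ) : ℂ)

theorem continuous_symbol {n : ℕ} (z : Fin n → ℂ) : Continuous (symbol z) := by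
  unfold symbol
  fun_prop

theorem symbol_re {n : ℕ} (z : Fin n → ℂ) (p : SpaceTime n) :
    (symbol z p).re = ‖p.fst + imVec z‖ ^ 2 - ‖imVec z‖ ^ 2 := by
  rw [@norm_add_sq_real]
  simp [symbol, imVec, PiLp.inner_apply, Complex.mul_re, Complex.mul_im, pow_two]
  ring

theorem symbol_im {n : ℕ} (z : Fin n → ℂ) (p : SpaceTime n) :
    (symbol z p).im = -(p.snd + 2 * ∑ j, (z j).re * p.fst j) := by
  simp [symbol, Complex.mul_re, Complex.mul_im, pow_two]
  ring

theorem integrableOn_abs_rpow (r : ℝ) :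
    IntegrableOn (fun x : ℝ => |x| ^ (-(1 / 2) : ℝ)) (Metric.ball 0 r) := by
  refine integrableOn_ball_of_norm_le_rpow (C := 1) (α := 1 / 2) (by simp) (by simp; norm_num)
    (Filter.Eventually.of_forall fun x => ?_)
    (Measurable.aestronglyMeasurable (by fun_prop))
  simp [abs_of_nonneg (Real.rpow_nonneg (abs_nonneg x) _)]

theorem integrable_radial {n : ℕ} {b : EuclideanSpace ℝ (Fin n)} (hb : b ≠ 0) :
    Integrable (fun x : EuclideanSpace ℝ (Fin n) =>
      (Iio (1 + ‖b‖)).indicator (fun r : ℝ => |r - ‖b‖| ^ (-(1 / 2) : ℝ)) ‖x + b‖) := by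
  have : Nontrivial (EuclideanSpace ℝ (Fin n)) := ⟨b, 0, hb⟩
  refine Integrable.comp_add_right (f := fun x : EuclideanSpace ℝ (Fin n) =>
      (Iio (1 + ‖b‖)).indicator (fun r : ℝ => |r - ‖b‖| ^ (-(1 / 2) : ℝ)) ‖x‖) ?_ b
  rw [integrable_fun_norm_addHaar volume
    (f := (Iio (1 + ‖b‖)).indicator (fun r : ℝ => |r - ‖b‖| ^ (-(1 / 2) : ℝ)))]
  have h1 : IntegrableOn (fun r : ℝ => |r - ‖b‖| ^ (-(1 / 2) : ℝ)) (Ioo 0 (1 + ‖b‖)) := by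
    have h := integrableOn_abs_rpow (2 + ‖b‖)
    rw [← integrable_indicator_iff Metric.isOpen_ball.measurableSet] at h
    have h2 := (h.comp_sub_right ‖b‖).integrableOn (s := Ioo 0 (1 + ‖b‖))
    refine h2.congr_fun (fun x hx => ?_) measurableSet_Ioo
    have : x - ‖b‖ ∈ Metric.ball (0 : ℝ) (2 + ‖b‖) := by
      rw [mem_ball_zero_iff, Real.norm_eq_abs, abs_lt]
      constructor <;> linarith [hx.1, hx.2, norm_nonneg b]
    simp [indicator_of_mem this]
  have h3 : IntegrableOn (fun r : ℝ => (1 + ‖b‖) ^ (Module.finrank ℝ (EuclideanSpace ℝ (Fin n)) - 1)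
      * |r - ‖b‖| ^ (-(1 / 2) : ℝ)) (Ioo 0 (1 + ‖b‖)) := h1.const_mul _
  rw [← integrable_indicator_iff measurableSet_Ioo] at h3
  refine (h3.integrableOn (s := Ioi 0)).mono' ?_ ?_
  · refine Measurable.aestronglyMeasurable ?_
    have hm : Measurable ((Iio (1 + ‖b‖)).indicator (fun r : ℝ => |r - ‖b‖| ^ (-(1 / 2) : ℝ))) :=
      Measurable.indicator (by fun_prop) measurableSet_Iio
    have hp : Measurable fun r : ℝ => r ^ (Module.finrank ℝ (EuclideanSpace ℝ (Fin n)) - 1) := by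
      fun_prop
    exact hp.smul hm
  · refine (ae_restrict_iff' measurableSet_Ioi).2 (Filter.Eventually.of_forall fun r hr => ?_)
    have hr' : (0 : ℝ) < r := hr
    by_cases h : r < 1 + ‖b‖
    · rw [indicator_of_mem (show r ∈ Iio (1 + ‖b‖) from h),
        indicator_of_mem (show r ∈ Ioo 0 (1 + ‖b‖) from ⟨hr, h⟩), norm_smul, norm_pow,
        Real.norm_of_nonneg hr'.le, Real.norm_of_nonneg (by positivity)]
      gcongr
    · rw [indicator_of_notMem (show r ∉ Iio (1 + ‖b‖) from h),
        indicator_of_notMem (fun h' : r ∈ Ioo 0 (1 + ‖b‖) => h h'.2)]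
      simp

/-- The elementary pointwise bound near the zero set. -/
theorem norm_inv_le {β r s : ℝ} (hβ : 0 < β) (hr : 0 ≤ r) (hrβ : r ≠ β) (hs : s ≠ 0) {w : ℂ}
    (hre : w.re = r ^ 2 - β ^ 2) (him : w.im = -s) :
    ‖w⁻¹‖ ≤ 1 + β ^ (-(1 / 2) : ℝ) * ((Iio (1 + β)).indicator
      (fun r : ℝ => |r - β| ^ (-(1 / 2) : ℝ)) r *
        (Metric.ball (0 : ℝ) 1).indicator (fun s : ℝ => |s| ^ (-(1 / 2) : ℝ)) s) := by
  rw [norm_inv]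
  by_cases hw : 1 ≤ ‖w‖
  · refine (inv_le_one_of_one_le₀ hw).trans (le_add_of_nonneg_right ?_)
    have h1 : 0 ≤ (Iio (1 + β)).indicator (fun r : ℝ => |r - β| ^ (-(1 / 2) : ℝ)) r :=
      indicator_nonneg (fun _ _ => by positivity) _
    have h2 : 0 ≤ (Metric.ball (0 : ℝ) 1).indicator (fun s : ℝ => |s| ^ (-(1 / 2) : ℝ)) s :=
      indicator_nonneg (fun _ _ => by positivity) _
    positivity
  · push Not at hw
    have hs1 : |s| ≤ ‖w‖ := by simpa [him] using Complex.abs_im_le_norm w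
    have hu1 : |r ^ 2 - β ^ 2| ≤ ‖w‖ := by simpa [hre] using Complex.abs_re_le_norm w
    have hrlt : r < 1 + β := by
      by_contra! h
      have := (le_abs_self _).trans (hu1.trans hw.le)
      nlinarith
    rw [indicator_of_mem (show r ∈ Iio (1 + β) from hrlt),
      indicator_of_mem (show s ∈ Metric.ball (0 : ℝ) 1 by simpa using hs1.trans_lt hw)]
    have hrb : 0 < |r - β| := abs_pos.2 (sub_ne_zero.2 hrβ)
    have hspos : 0 < |s| := abs_pos.2 hs
    have hwpos : 0 < ‖w‖ := hspos.trans_le hs1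
    rw [← Real.mul_rpow hrb.le hspos.le, ← Real.mul_rpow hβ.le (by positivity)]
    have hle : β * (|r - β| * |s|) ≤ ‖w‖ ^ 2 := by
      have : β * |r - β| ≤ ‖w‖ := by
        refine le_trans ?_ hu1
        rw [sq_sub_sq, abs_mul, abs_of_nonneg (by positivity : 0 ≤ r + β)]
        gcongr
        linarith
      calc β * (|r - β| * |s|) = (β * |r - β|) * |s| := by ring
        _ ≤ ‖w‖ * ‖w‖ := by gcongr
        _ = _ := by ring
    have := Real.rpow_le_rpow_of_nonpos (by positivity) hle (by norm_num : (-(1 / 2) : ℝ) ≤ 0)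
    rw [← Real.rpow_natCast, ← Real.rpow_mul hwpos.le] at this
    norm_num [Real.rpow_neg_one] at this ⊢
    linarith

/-- `1 / P_z` is integrable against a power of `1 / (1 + |p|)`. -/
theorem integrable_inv_symbol {n : ℕ} (z : Fin n → ℂ) (hz : imVec z ≠ 0) :
    ∃ k : ℕ, Integrable fun p : SpaceTime n => (1 + ‖p‖) ^ (-(k : ℝ)) * ‖(symbol z p)⁻¹‖ := by
  obtain ⟨k, hk⟩ := Measure.HasTemperateGrowth.exists_integrable
    (μ := (volume : Measure (SpaceTime n)))
  refine ⟨k, ?_⟩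
  set b := imVec z with hbdef
  have hb : 0 < ‖b‖ := norm_pos_iff.2 hz
  set φ : EuclideanSpace ℝ (Fin n) → ℝ := fun x =>
      (Iio (1 + ‖b‖)).indicator (fun r : ℝ => |r - ‖b‖| ^ (-(1 / 2) : ℝ)) ‖x + b‖ with hφ
  set ψ : ℝ → ℝ := (Metric.ball (0 : ℝ) 1).indicator (fun s : ℝ => |s| ^ (-(1 / 2) : ℝ)) with hψ
  set ℓ : EuclideanSpace ℝ (Fin n) → ℝ := fun x => 2 * ∑ j, (z j).re * x j with hℓ
  have hφi : Integrable φ := integrable_radial hz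
  have hψi : Integrable ψ :=
    (integrable_indicator_iff Metric.isOpen_ball.measurableSet).2 (integrableOn_abs_rpow 1)
  have hφm : Measurable φ := by
    have h : Measurable ((Iio (1 + ‖b‖)).indicator (fun r : ℝ => |r - ‖b‖| ^ (-(1 / 2) : ℝ))) :=
      Measurable.indicator (by fun_prop) measurableSet_Iio
    exact h.comp (by fun_prop)
  have hψm : Measurable ψ := Measurable.indicator (by fun_prop) Metric.isOpen_ball.measurableSet
  have hℓm : Measurable ℓ := by fun_prop
  have hprod : Integrable (fun q : EuclideanSpace ℝ (Fin n) × ℝ => φ q.1 * ψ (q.2 + ℓ q.1)) := by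
    have hm : Measurable fun q : EuclideanSpace ℝ (Fin n) × ℝ => φ q.1 * ψ (q.2 + ℓ q.1) := by
      fun_prop
    rw [Measure.volume_eq_prod, integrable_prod_iff hm.aestronglyMeasurable]
    refine ⟨Filter.Eventually.of_forall fun x => (hψi.comp_add_right (ℓ x)).const_mul (φ x), ?_⟩
    have : (fun x => ∫ y, ‖φ x * ψ (y + ℓ x)‖) = fun x => ‖φ x‖ * ∫ y, ‖ψ y‖ := by
      funext x
      simp_rw [norm_mul, integral_const_mul]
      rw [integral_add_right_eq_self (fun y => ‖ψ y‖) (ℓ x)]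
    rw [this]
    exact hφi.norm.mul_const _
  have hmp := WithLp.volume_preserving_ofLp (EuclideanSpace ℝ (Fin n)) ℝ
  have hprod' : Integrable fun p : SpaceTime n => φ p.fst * ψ (p.snd + ℓ p.fst) :=
    hmp.integrable_comp_of_integrable hprod
  have hmaj := hk.add (hprod'.const_mul (‖b‖ ^ (-(1 / 2) : ℝ)))
  refine hmaj.mono' ?_ ?_
  · refine Measurable.aestronglyMeasurable ?_
    have := (continuous_symbol z).measurable
    exact Measurable.mul (by fun_prop) this.inv.norm
  · have hae : ∀ᵐ q : EuclideanSpace ℝ (Fin n) × ℝ, ‖q.1 + b‖ ≠ ‖b‖ ∧ q.2 + ℓ q.1 ≠ 0 := by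
      have hms : MeasurableSet {q : EuclideanSpace ℝ (Fin n) × ℝ |
          ‖q.1 + b‖ ≠ ‖b‖ ∧ q.2 + ℓ q.1 ≠ 0} := by
        refine MeasurableSet.inter ?_ ?_
        · exact (measurableSet_eq_fun (by fun_prop) (by fun_prop)).compl
        · exact (measurableSet_eq_fun (by fun_prop) (by fun_prop)).compl
      rw [Measure.volume_eq_prod, Measure.ae_prod_iff_ae_ae hms]
      have hsph : ∀ᵐ x : EuclideanSpace ℝ (Fin n), ‖x + b‖ ≠ ‖b‖ := by
        have h0 : volume (Metric.sphere (-b) ‖b‖) = 0 :=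
          Measure.addHaar_sphere_of_ne_zero _ _ hb.ne'
        refine measure_mono_null (fun x hx => ?_) h0
        simpa [dist_eq_norm, sub_neg_eq_add] using hx
      filter_upwards [hsph] with x hx
      filter_upwards [compl_mem_ae_iff.2 (measure_singleton (μ := (volume : Measure ℝ)) (-ℓ x))]
        with y hy
      refine ⟨hx, fun h => hy ?_⟩
      simp only [mem_singleton_iff]
      linarith
    filter_upwards [hmp.quasiMeasurePreserving.ae hae] with p hp
    have hle := norm_inv_le hb (norm_nonneg _) hp.1 hp.2 (w := symbol z p) (symbol_re z p)
      (symbol_im z p)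
    have h1 : (1 + ‖p‖) ^ (-(k : ℝ)) ≤ 1 :=
      Real.rpow_le_one_of_one_le_of_nonpos (by linarith [norm_nonneg p]) (by simp)
    have h0 : 0 ≤ (1 + ‖p‖) ^ (-(k : ℝ)) := by positivity
    have hnn : 0 ≤ ‖b‖ ^ (-(1 / 2) : ℝ) * (φ p.fst * ψ (p.snd + ℓ p.fst)) := by
      have h1 : 0 ≤ φ p.fst := indicator_nonneg (fun _ _ => by positivity) _
      have h2 : 0 ≤ ψ (p.snd + ℓ p.fst) := indicator_nonneg (fun _ _ => by positivity) _
      positivity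
    rw [Real.norm_of_nonneg (by positivity)]
    calc _ ≤ (1 + ‖p‖) ^ (-(k : ℝ)) *
          (1 + ‖b‖ ^ (-(1 / 2) : ℝ) * (φ p.fst * ψ (p.snd + ℓ p.fst))) := by gcongr; exact hle
      _ ≤ (1 + ‖p‖) ^ (-(k : ℝ)) + ‖b‖ ^ (-(1 / 2) : ℝ) * (φ p.fst * ψ (p.snd + ℓ p.fst)) := by
        nlinarith

theorem exists_bound_inv_symbol_mul {n : ℕ} (z : Fin n → ℂ) (k : ℕ) (f : 𝓢(SpaceTime n, ℂ))
    (p : SpaceTime n) :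
    ‖(symbol z p)⁻¹ * f p‖ ≤ ((1 + ‖p‖) ^ (-(k : ℝ)) * ‖(symbol z p)⁻¹‖) *
      (2 ^ k * ((Finset.Iic (k, 0)).sup (schwartzSeminormFamily ℂ (SpaceTime n) ℂ)) f) := by
  have h := SchwartzMap.one_add_le_sup_seminorm_apply (𝕜 := ℂ) (m := (k, 0)) (k := k) (n := 0)
    le_rfl le_rfl f p
  rw [norm_iteratedFDeriv_zero] at h
  have hpos : 0 < (1 + ‖p‖) ^ k := by positivity
  rw [norm_mul, Real.rpow_neg (by positivity), Real.rpow_natCast]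
  have h2 : ‖f p‖ ≤ ((1 + ‖p‖) ^ k)⁻¹ *
      (2 ^ k * ((Finset.Iic (k, 0)).sup (schwartzSeminormFamily ℂ (SpaceTime n) ℂ)) f) := by
    rw [← div_eq_inv_mul, le_div_iff₀' hpos]
    exact h
  calc _ ≤ ‖(symbol z p)⁻¹‖ * (((1 + ‖p‖) ^ k)⁻¹ *
      (2 ^ k * ((Finset.Iic (k, 0)).sup (schwartzSeminormFamily ℂ (SpaceTime n) ℂ)) f)) := by gcongr
    _ = _ := by ring

theorem integrable_inv_symbol_mul {n : ℕ} (z : Fin n → ℂ) (hz : imVec z ≠ 0)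
    (f : 𝓢(SpaceTime n, ℂ)) : Integrable fun p => (symbol z p)⁻¹ * f p := by
  obtain ⟨k, hk⟩ := integrable_inv_symbol z hz
  refine (hk.mul_const _).mono' ?_ (Filter.Eventually.of_forall
    (exists_bound_inv_symbol_mul z k f))
  have := (continuous_symbol z).measurable
  exact (this.inv.mul f.continuous.measurable).aestronglyMeasurable

theorem norm_integral_inv_symbol_le {n : ℕ} (z : Fin n → ℂ) (hz : imVec z ≠ 0) :
    ∃ (s : Finset (ℕ × ℕ)) (C : ℝ), 0 ≤ C ∧ ∀ f : 𝓢(SpaceTime n, ℂ),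
      ‖∫ p, (symbol z p)⁻¹ * f p‖ ≤ C * s.sup (schwartzSeminormFamily ℂ (SpaceTime n) ℂ) f := by
  obtain ⟨k, hk⟩ := integrable_inv_symbol z hz
  refine ⟨Finset.Iic (k, 0),
    (∫ p : SpaceTime n, (1 + ‖p‖) ^ (-(k : ℝ)) * ‖(symbol z p)⁻¹‖) * 2 ^ k, by positivity,
    fun f => ?_⟩
  refine (norm_integral_le_of_norm_le (hk.mul_const _) (Filter.Eventually.of_forall
    (exists_bound_inv_symbol_mul z k f))).trans_eq ?_
  rw [integral_mul_const, mul_assoc]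

/-- The tempered distribution `1 / P_z`, `φ ↦ ∫ φ / P_z`. -/
noncomputable def invSymbolDist {n : ℕ} (z : Fin n → ℂ) (hz : imVec z ≠ 0) :
    𝓢(SpaceTime n, ℂ) →L[ℂ] ℂ :=
  have hint (f : 𝓢(SpaceTime n, ℂ)) : Integrable fun p => (symbol z p)⁻¹ * f p :=
    integrable_inv_symbol_mul z hz f
  SchwartzMap.mkCLMtoNormedSpace (fun f => ∫ p, (symbol z p)⁻¹ * f p)
    (fun f g => by
      simp only [add_apply, mul_add]
      exact integral_add (hint f) (hint g))
    (fun a f => by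
      simp only [smul_apply, smul_eq_mul, RingHom.id_apply]
      rw [← integral_const_mul]
      congr 1 with p
      ring)
    (norm_integral_inv_symbol_le z hz)

/-- The inverse Fourier transform of a test function in the normalization
`(𝓕⁻¹φ)(ξ, η) = (2π)^{-(n+1)} ∫ e^{i(x·ξ + tη)} φ(x, t) dx dt`, expressed through Mathlib's
transform `∫ e^{2πi⟨q, p⟩} φ(q) dq`; see `invFourier_apply`. -/
noncomputable def invFourier (n : ℕ) : 𝓢(SpaceTime n, ℂ) →L[ℂ] 𝓢(SpaceTime n, ℂ) :=
  (((2 * Real.pi) ^ (n + 1) : ℝ) : ℂ)⁻¹ •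
    (SchwartzMap.compCLMOfContinuousLinearEquiv ℂ
      (ContinuousLinearEquiv.smulLeft (R₁ := ℝ) (M₁ := SpaceTime n)
        (Units.mk0 ((2 * Real.pi)⁻¹ : ℝ) (by positivity))) ∘L
      FourierTransform.fourierInvCLM ℂ 𝓢(SpaceTime n, ℂ))

theorem invFourier_apply {n : ℕ} (f : 𝓢(SpaceTime n, ℂ)) (p : SpaceTime n) :
    invFourier n f p = (((2 * Real.pi) ^ (n + 1) : ℝ) : ℂ)⁻¹ *
      ∫ q : SpaceTime n,
        Complex.exp (Complex.I * ((∑ j, q.fst j * p.fst j + q.snd * p.snd : ℝ) : ℂ)) * f q := by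
  have h : invFourier n f p = (((2 * Real.pi) ^ (n + 1) : ℝ) : ℂ)⁻¹ *
      (𝓕⁻ f) (((2 * Real.pi)⁻¹ : ℝ) • p) := rfl
  rw [h, SchwartzMap.fourierInv_coe, Real.fourierInv_eq']
  congr 2 with q
  have hin : 2 * Real.pi * inner ℝ q ((2 * Real.pi)⁻¹ • p) =
      ∑ j, q.fst j * p.fst j + q.snd * p.snd := by
    rw [real_inner_smul_right, ← mul_assoc, mul_inv_cancel₀ Real.two_pi_pos.ne', one_mul,
      WithLp.prod_inner_apply]
    simp [PiLp.inner_apply, mul_comm]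
  rw [smul_eq_mul, hin, mul_comm Complex.I]

/-- The tempered distribution `G_z`, the inverse Fourier transform of `1 / P_z`. -/
noncomputable def fundamentalSolution {n : ℕ} (z : Fin n → ℂ) (hz : imVec z ≠ 0) :
    𝓢'(SpaceTime n, ℂ) :=
  ContinuousLinearMap.toPointwiseConvergenceCLM _ _ _ _ (invSymbolDist z hz ∘L invFourier n)

theorem fundamentalSolution_apply {n : ℕ} (z : Fin n → ℂ) (hz : imVec z ≠ 0)
    (f : 𝓢(SpaceTime n, ℂ)) :
    fundamentalSolution z hz f = ∫ p, (symbol z p)⁻¹ * invFourier n f p := rfl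

/-- The test function `q ↦ g (p - q)`. -/
noncomputable def reflectTranslate {n : ℕ} (g : 𝓢(SpaceTime n, ℂ)) (p : SpaceTime n) :
    𝓢(SpaceTime n, ℂ) :=
  SchwartzMap.compSubConstCLM ℂ p
    (SchwartzMap.compCLMOfContinuousLinearEquiv ℂ (ContinuousLinearEquiv.neg ℝ) g)

theorem reflectTranslate_apply {n : ℕ} (g : 𝓢(SpaceTime n, ℂ)) (p q : SpaceTime n) :
    reflectTranslate g p q = g (p - q) := by
  simp [reflectTranslate]

/-- The convolution `u * g` of a tempered distribution and a rapidly decreasing function, i.e. the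
function `p ↦ ⟨u, g (p - ·)⟩`. -/
noncomputable def conv {n : ℕ} (u : 𝓢'(SpaceTime n, ℂ))
    (g : 𝓢(SpaceTime n, ℂ)) : SpaceTime n → ℂ :=
  fun p => u (reflectTranslate g p)

/-- The partial derivative `∂f/∂x_j`. -/
noncomputable def partialX {n : ℕ} (j : Fin n) (f : SpaceTime n → ℂ) : SpaceTime n → ℂ :=
  fun p => lineDeriv ℝ f p (WithLp.toLp 2 (EuclideanSpace.single j 1, 0))

/-- The partial derivative `D_t f = ∂f/∂t`. -/
noncomputable def partialT {n : ℕ} (f : SpaceTime n → ℂ) : SpaceTime n → ℂ :=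
  fun p => lineDeriv ℝ f p (WithLp.toLp 2 (0, 1))

/-- `D_x^α f = ∂_{x_1}^{α_1} ⋯ ∂_{x_n}^{α_n} f` for a multi-index `α`. -/
noncomputable def derivX {n : ℕ} (α : Fin n → ℕ) (f : SpaceTime n → ℂ) : SpaceTime n → ℂ :=
  (List.finRange n).foldr (fun j h => (partialX j)^[α j] h) f

/-- The measure `(1 + |x|² + t²)^s dx dt`. -/
noncomputable def weightMeasure (n : ℕ) (s : ℝ) : Measure (SpaceTime n) :=
  volume.withDensity fun p => ENNReal.ofReal ((1 + ‖p.fst‖ ^ 2 + p.snd ^ 2) ^ s)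

/-- The space `L²_s(ℝⁿ⁺¹)` of all `f` with `∫ |f|² (1 + |x|² + t²)^s dx dt < ∞`, normed by the
square root of this integral. -/
abbrev WeightedL2 (n : ℕ) (s : ℝ) : Type := Lp ℂ 2 (weightMeasure n s)

/-- `‖f‖_s = (∫ |f|² (1 + |x|² + t²)^s dx dt)^{1/2}`, with values in `[0, ∞]`. -/
noncomputable def weightedNorm {n : ℕ} (s : ℝ) (f : SpaceTime n → ℂ) : ℝ≥0∞ :=
  (∫⁻ p, ‖f p‖ₑ ^ 2 * ENNReal.ofReal ((1 + ‖p.fst‖ ^ 2 + p.snd ^ 2) ^ s)) ^ (1 / 2 : ℝ)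

theorem weightedNorm_eq {n : ℕ} (s : ℝ) (f : SpaceTime n → ℂ) :
    weightedNorm s f = eLpNorm f 2 (weightMeasure n s) := by
  rw [weightedNorm, eLpNorm_eq_lintegral_rpow_enorm_toReal (by norm_num) (by norm_num),
    weightMeasure, lintegral_withDensity_eq_lintegral_mul_non_measurable _
      (by fun_prop) (by simp)]
  simp [mul_comm]

instance instTemperateWeightMeasure (n : ℕ) (s : ℝ) :
    (weightMeasure n s).HasTemperateGrowth := by
  obtain ⟨k, hk⟩ := Measure.HasTemperateGrowth.exists_integrable
    (μ := (volume : Measure (SpaceTime n)))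
  obtain ⟨m, hm⟩ := exists_nat_ge (2 * |s|)
  refine ⟨⟨k + m, ?_⟩⟩
  have hmeas : Measurable fun p : SpaceTime n => (1 + ‖p.fst‖ ^ 2 + p.snd ^ 2) ^ s := by fun_prop
  rw [weightMeasure, integrable_withDensity_iff hmeas.ennreal_ofReal (by simp)]
  refine hk.mono' (Measurable.aestronglyMeasurable (by fun_prop))
    (Filter.Eventually.of_forall fun p => ?_)
  have hn : 1 + ‖p.fst‖ ^ 2 + p.snd ^ 2 = 1 + ‖p‖ ^ 2 := by
    rw [WithLp.prod_norm_sq_eq_of_L2, Real.norm_eq_abs, sq_abs, add_assoc]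
  have h1 : (1 + ‖p‖ ^ 2) ^ s ≤ (1 + ‖p‖) ^ (m : ℝ) := by
    have hp := norm_nonneg p
    calc (1 + ‖p‖ ^ 2) ^ s ≤ (1 + ‖p‖ ^ 2) ^ |s| :=
          Real.rpow_le_rpow_of_exponent_le (by nlinarith) (le_abs_self s)
      _ ≤ ((1 + ‖p‖) ^ (2 : ℝ)) ^ |s| := by
          refine Real.rpow_le_rpow (by positivity) ?_ (abs_nonneg s)
          rw [Real.rpow_two]
          nlinarith
      _ = (1 + ‖p‖) ^ (2 * |s|) := by rw [← Real.rpow_mul (by positivity)]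
      _ ≤ _ := Real.rpow_le_rpow_of_exponent_le (by linarith) hm
  rw [hn, ENNReal.toReal_ofReal (by positivity), Real.norm_of_nonneg (by positivity)]
  calc (1 + ‖p‖) ^ (-((k + m : ℕ) : ℝ)) * (1 + ‖p‖ ^ 2) ^ s
      ≤ (1 + ‖p‖) ^ (-((k + m : ℕ) : ℝ)) * (1 + ‖p‖) ^ (m : ℝ) := by gcongr
    _ = (1 + ‖p‖) ^ (-(k : ℝ)) := by
      rw [← Real.rpow_add (by positivity)]
      congr 1
      push_cast
      ring

end BackwardHeat

open BackwardHeat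

namespace BackwardHeat

/-! On the frequency side `G_z * g` is `𝓕 g / P_z`, so by Parseval its pairing with a test function
`ψ` is an integral of `𝓕 g · 𝓕⁻ ψ / P_z`. Write `1/|P_z| = |P_z|^{-(δ+1)} |P_z|^{δ}` and apply
Cauchy-Schwarz. Both factors are then instances of one estimate, valid for `0 < σ < 1`: `∫ |f|²
|P_z|^{-2σ} ≤ C ∫ |𝓕 f|² (1+|x|²+t²)^σ`, used with `σ = δ+1` for `f = 𝓕 g` and with `σ = -δ` for `f
= 𝓕⁻ ψ` (`lintegral_invSymbol_rpow_le`).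

For this estimate, bound `|P_z|²` below by `|Re P_z| |Im P_z|`. The imaginary part vanishes to first
order on a hyperplane that is a graph over `ξ`. The real part vanishes on a cylinder over a sphere
of radius `|b| ≥ R`; near the sphere some coordinate is bounded below, and there the real part
dominates the distance, measured in that coordinate, to one of the two sheets of the sphere. Thus
`|P_z|^{-2σ}` is dominated by sums of products of at most two one-dimensional singularities `|s -
c|^{-σ}` in orthogonal directions, with `c` independent of `s`. The fractional Hardy inequality
(`hardy_line`) absorbs each at the price of `σ/2` derivatives in its direction. By Plancherel these
become the weights `|t|^σ` and `|t|^σ |x_j|^σ`, both at most `(1+|x|²+t²)^σ`. Only translation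
invariance along lines is used, so `a` does not enter the constant.

Derivatives multiply the data by `ξ^α` or `η`. Either `|ξ| ≤ 4|b|`, or `P_z` is elliptic of order
two in `ξ`; hence these multipliers over `P_z` are controlled by `1/|P_z|` plus a bounded term, and
the latter costs only Plancherel. The factor `√(1+|a|²) + |a|` is at least one and is inserted at
the end. The bounded extension follows from density of Schwartz functions. -/

/-! ### The fractional Hardy inequality on the line -/

theorem lintegral_comp_const_mul {a : ℝ} (ha : a ≠ 0) (F : ℝ → ℝ≥0∞) :
    ∫⁻ x, F (a * x) = ENNReal.ofReal |a⁻¹| * ∫⁻ x, F x := by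
  have h := (Homeomorph.mulLeft₀ a ha).measurableEmbedding.lintegral_map (μ := volume) F
  simp only [Homeomorph.coe_mulLeft₀] at h
  rw [← h, Real.map_volume_mul_left ha, lintegral_smul_measure, smul_eq_mul]

theorem enorm_sq_le_add {ε : ℝ} (hε : 0 < ε) (a b : ℂ) :
    ‖a‖ₑ ^ 2 ≤ ENNReal.ofReal (1 + ε) * ‖b‖ₑ ^ 2 +
      ENNReal.ofReal (1 + ε⁻¹) * ‖b - a‖ₑ ^ 2 := by
  have key : ‖a‖ ^ 2 ≤ (1 + ε) * ‖b‖ ^ 2 + (1 + ε⁻¹) * ‖b - a‖ ^ 2 := by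
    have h1 : ‖a‖ ≤ ‖b‖ + ‖b - a‖ := by
      have := norm_sub_le b (b - a)
      simpa using this
    have h2 : ‖a‖ ^ 2 ≤ (‖b‖ + ‖b - a‖) ^ 2 := by gcongr
    have h3 : 0 ≤ ε⁻¹ * (ε * ‖b‖ - ‖b - a‖) ^ 2 := by positivity
    have h4 : ε⁻¹ * (ε * ‖b‖ - ‖b - a‖) ^ 2 =
        ε * ‖b‖ ^ 2 - 2 * ‖b‖ * ‖b - a‖ + ε⁻¹ * ‖b - a‖ ^ 2 := by
      field_simp
      ring
    nlinarith
  simp only [← ofReal_norm]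
  rw [← ENNReal.ofReal_pow (norm_nonneg _), ← ENNReal.ofReal_pow (norm_nonneg _),
    ← ENNReal.ofReal_pow (norm_nonneg _), ← ENNReal.ofReal_mul (by positivity),
    ← ENNReal.ofReal_mul (by positivity), ← ENNReal.ofReal_add (by positivity) (by positivity)]
  exact ENNReal.ofReal_le_ofReal key

theorem le_mul_of_le_mul_self_add {I B : ℝ≥0∞} {θ : ℝ} (hθ0 : 0 ≤ θ) (hθ : θ < 1) (hI : I ≠ ⊤)
    (h : I ≤ ENNReal.ofReal θ * I + B) : I ≤ ENNReal.ofReal (1 - θ)⁻¹ * B := by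
  have hpos : 0 < 1 - θ := by linarith
  rcases eq_or_ne B ⊤ with rfl | hB
  · rw [ENNReal.mul_top (by simpa using hθ)]
    exact le_top
  lift I to NNReal using hI
  lift B to NNReal using hB
  lift θ to NNReal using hθ0
  have h' : (I : ℝ) ≤ θ * I + B := by
    rw [ENNReal.ofReal_coe_nnreal] at h
    exact_mod_cast h
  rw [← ENNReal.ofReal_coe_nnreal, ← ENNReal.ofReal_coe_nnreal,
    ← ENNReal.ofReal_mul (by positivity)]
  apply ENNReal.ofReal_le_ofReal
  rw [← div_eq_inv_mul, le_div_iff₀ hpos]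
  linarith

/-- Replacing `f s` by `f (l * s)` with `l ≥ 2` multiplies the left side by `l ^ (σ - 1) < 1`, so up
to the error `f (l * s) - f s` the left side is at most a proper fraction of itself and can be
absorbed, being finite. Averaging the error over `l ∈ [2, 3]` and substituting `h = s * (l - 1)`
gives the double integral. -/
theorem hardy_line {σ : ℝ} (h0 : 0 < σ) (h1 : σ < 1) : ∃ C : ℝ≥0∞, C ≠ ⊤ ∧ ∀ f : ℝ → ℂ,
    Measurable f → ∫⁻ s, ‖f s‖ₑ ^ 2 * ‖s‖ₑ ^ (-σ) ≠ ⊤ →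
    ∫⁻ s, ‖f s‖ₑ ^ 2 * ‖s‖ₑ ^ (-σ) ≤
      C * ∫⁻ s, ∫⁻ h, ‖h‖ₑ ^ (-1 - σ) * ‖f (s + h) - f s‖ₑ ^ 2 := by
  have h21 : (2 : ℝ) ^ (σ - 1) < 1 := Real.rpow_lt_one_of_one_lt_of_neg (by norm_num) (by linarith)
  have h2p : (0 : ℝ) < 2 ^ (σ - 1) := by positivity
  obtain ⟨ε, hε, hθ⟩ : ∃ ε : ℝ, 0 < ε ∧ (1 + ε) * 2 ^ (σ - 1) < 1 := by
    -- With `q = 2 ^ (σ - 1)`, this makes `(1 + ε) * q` the midpoint `(1 + q) / 2` of `q` and `1`.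
    refine ⟨((2 ^ (σ - 1))⁻¹ - 1) / 2, ?_, ?_⟩
    · have := (one_lt_inv₀ h2p).2 h21
      linarith
    · field_simp
      linarith
  refine ⟨ENNReal.ofReal (1 - (1 + ε) * 2 ^ (σ - 1))⁻¹ *
    (ENNReal.ofReal (1 + ε⁻¹) * ENNReal.ofReal (2 ^ (1 + σ))), by finiteness, fun f hf hI => ?_⟩
  set I := ∫⁻ s, ‖f s‖ₑ ^ 2 * ‖s‖ₑ ^ (-σ) with hIdef
  set D := ∫⁻ s, ∫⁻ h, ‖h‖ₑ ^ (-1 - σ) * ‖f (s + h) - f s‖ₑ ^ 2 with hD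
  have hdil : ∀ l ∈ Icc (2 : ℝ) 3, ∫⁻ s, ‖f (l * s)‖ₑ ^ 2 * ‖s‖ₑ ^ (-σ) ≤
      ENNReal.ofReal (2 ^ (σ - 1)) * I := by
    intro l hl
    have hl0 : 0 < l := by linarith [hl.1]
    have e1 : ∀ s, ‖f (l * s)‖ₑ ^ 2 * ‖s‖ₑ ^ (-σ) =
        ENNReal.ofReal (l ^ σ) * (‖f (l * s)‖ₑ ^ 2 * ‖l * s‖ₑ ^ (-σ)) := by
      intro s
      rw [enorm_mul, ENNReal.mul_rpow_of_ne_top enorm_ne_top enorm_ne_top,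
        Real.enorm_of_nonneg hl0.le, ENNReal.ofReal_rpow_of_pos hl0,
        mul_left_comm, ← mul_assoc (ENNReal.ofReal (l ^ σ)), ← ENNReal.ofReal_mul (by positivity),
        ← Real.rpow_add hl0]
      simp
    simp_rw [e1]
    rw [lintegral_const_mul' _ _ ENNReal.ofReal_ne_top,
      lintegral_comp_const_mul hl0.ne' (fun s => ‖f s‖ₑ ^ 2 * ‖s‖ₑ ^ (-σ)), ← mul_assoc,
      ← ENNReal.ofReal_mul (by positivity), abs_of_pos (by positivity)]
    gcongr
    rw [← Real.rpow_neg_one, ← Real.rpow_add hl0, ← sub_eq_add_neg]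
    exact Real.rpow_le_rpow_of_nonpos (by norm_num) hl.1 (by linarith)
  have hstep : ∀ l ∈ Icc (2 : ℝ) 3, I ≤ ENNReal.ofReal ((1 + ε) * 2 ^ (σ - 1)) * I +
      ENNReal.ofReal (1 + ε⁻¹) * ∫⁻ s, ‖f (l * s) - f s‖ₑ ^ 2 * ‖s‖ₑ ^ (-σ) := by
    intro l hl
    calc I ≤ ∫⁻ s, (ENNReal.ofReal (1 + ε) * (‖f (l * s)‖ₑ ^ 2 * ‖s‖ₑ ^ (-σ)) +
          ENNReal.ofReal (1 + ε⁻¹) * (‖f (l * s) - f s‖ₑ ^ 2 * ‖s‖ₑ ^ (-σ))) := by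
          refine lintegral_mono fun s => ?_
          rw [← mul_assoc, ← mul_assoc, ← add_mul]
          gcongr
          exact enorm_sq_le_add hε _ _
      _ = ENNReal.ofReal (1 + ε) * (∫⁻ s, ‖f (l * s)‖ₑ ^ 2 * ‖s‖ₑ ^ (-σ)) +
          ENNReal.ofReal (1 + ε⁻¹) * ∫⁻ s, ‖f (l * s) - f s‖ₑ ^ 2 * ‖s‖ₑ ^ (-σ) := by
          rw [lintegral_add_left (by fun_prop), lintegral_const_mul' _ _ ENNReal.ofReal_ne_top,
            lintegral_const_mul' _ _ ENNReal.ofReal_ne_top]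
      _ ≤ _ := by
          rw [ENNReal.ofReal_mul (by positivity), mul_assoc]
          gcongr
          exact hdil l hl
  have hpt : ∀ s : ℝ, s ≠ 0 → ∫⁻ l in Icc (2 : ℝ) 3, ‖f (l * s) - f s‖ₑ ^ 2 * ‖s‖ₑ ^ (-σ) ≤
      ENNReal.ofReal (2 ^ (1 + σ)) * ∫⁻ h, ‖h‖ₑ ^ (-1 - σ) * ‖f (s + h) - f s‖ₑ ^ 2 := by
    intro s hs
    have hs' : 0 < |s| := abs_pos.2 hs
    calc ∫⁻ l in Icc (2 : ℝ) 3, ‖f (l * s) - f s‖ₑ ^ 2 * ‖s‖ₑ ^ (-σ)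
        ≤ ∫⁻ l in Icc (2 : ℝ) 3, ENNReal.ofReal (2 ^ (1 + σ)) * (ENNReal.ofReal |s| *
            (‖s * (l - 1)‖ₑ ^ (-1 - σ) * ‖f (s + s * (l - 1)) - f s‖ₑ ^ 2)) := by
          refine setLIntegral_mono' measurableSet_Icc fun l hl => ?_
          have e : s + s * (l - 1) = l * s := by ring
          rw [e, mul_comm, ← mul_assoc, ← mul_assoc]
          gcongr
          have hl1 : 0 < l - 1 := by linarith [hl.1]
          have hb : 0 < |s * (l - 1)| := by
            rw [abs_mul, abs_of_pos hl1]
            positivity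
          rw [← ofReal_norm, ← ofReal_norm, Real.norm_eq_abs, Real.norm_eq_abs,
            ENNReal.ofReal_rpow_of_pos hs', ENNReal.ofReal_rpow_of_pos hb,
            ← ENNReal.ofReal_mul (by positivity), ← ENNReal.ofReal_mul (by positivity)]
          apply ENNReal.ofReal_le_ofReal
          have h3 : |s * (l - 1)| ≤ 2 * |s| := by
            rw [abs_mul, abs_of_pos hl1]
            nlinarith [hl.2]
          have h4 := Real.rpow_le_rpow_of_nonpos hb h3 (by linarith : -1 - σ ≤ 0)
          rw [Real.mul_rpow (by norm_num) hs'.le] at h4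
          -- The extra factor `|s|` is the Jacobian of `h = s * (l - 1)`; the constant `2 ^ (1 + σ)`
          -- comes from `|h| ≤ 2 * |s|`.
          have h5 : |s| ^ (-σ) = |s| * |s| ^ (-1 - σ) := by
            rw [← Real.rpow_one_add' hs'.le (by linarith)]
            ring_nf
          have h6 : (2 : ℝ) ^ (1 + σ) * 2 ^ (-1 - σ) = 1 := by
            rw [← Real.rpow_add (by norm_num)]
            simp
          calc |s| ^ (-σ) = 2 ^ (1 + σ) * |s| * (2 ^ (-1 - σ) * |s| ^ (-1 - σ)) := by
                rw [h5]; linear_combination (-(|s| * |s| ^ (-1 - σ))) * h6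
            _ ≤ _ := by gcongr
      _ ≤ ∫⁻ l, ENNReal.ofReal (2 ^ (1 + σ)) * (ENNReal.ofReal |s| *
            (‖s * (l - 1)‖ₑ ^ (-1 - σ) * ‖f (s + s * (l - 1)) - f s‖ₑ ^ 2)) :=
          setLIntegral_le_lintegral _ _
      _ = _ := by
          rw [lintegral_const_mul' _ _ ENNReal.ofReal_ne_top,
            lintegral_const_mul' _ _ ENNReal.ofReal_ne_top,
            lintegral_sub_right_eq_self (fun l => ‖s * l‖ₑ ^ (-1 - σ) * ‖f (s + s * l) - f s‖ₑ ^ 2),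
            lintegral_comp_const_mul hs (fun h => ‖h‖ₑ ^ (-1 - σ) * ‖f (s + h) - f s‖ₑ ^ 2),
            ← mul_assoc (ENNReal.ofReal |s|), ← ENNReal.ofReal_mul (abs_nonneg _), ← abs_mul,
            mul_inv_cancel₀ hs]
          simp
  have hJ : ∫⁻ l in Icc (2 : ℝ) 3, ∫⁻ s, ‖f (l * s) - f s‖ₑ ^ 2 * ‖s‖ₑ ^ (-σ) ≤
      ENNReal.ofReal (2 ^ (1 + σ)) * D := by
    rw [lintegral_lintegral_swap (Measurable.aemeasurable (by fun_prop)), hD,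
      ← lintegral_const_mul' _ _ ENNReal.ofReal_ne_top]
    refine lintegral_mono_ae ?_
    filter_upwards [compl_mem_ae_iff.2 (measure_singleton (μ := (volume : Measure ℝ)) 0)]
      with s hs using hpt s hs
  rw [mul_assoc]
  refine le_mul_of_le_mul_self_add (by positivity) hθ hI ?_
  have hvol : (volume : Measure ℝ) (Icc 2 3) = 1 := by
    rw [Real.volume_Icc]; norm_num
  calc I = ∫⁻ _ in Icc (2 : ℝ) 3, I := by rw [setLIntegral_const, hvol, mul_one]
    _ ≤ ∫⁻ l in Icc (2 : ℝ) 3, (ENNReal.ofReal ((1 + ε) * 2 ^ (σ - 1)) * I +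
      ENNReal.ofReal (1 + ε⁻¹) * ∫⁻ s, ‖f (l * s) - f s‖ₑ ^ 2 * ‖s‖ₑ ^ (-σ)) :=
        setLIntegral_mono' measurableSet_Icc hstep
    _ = ENNReal.ofReal ((1 + ε) * 2 ^ (σ - 1)) * I + ENNReal.ofReal (1 + ε⁻¹) *
        ∫⁻ l in Icc (2 : ℝ) 3, ∫⁻ s, ‖f (l * s) - f s‖ₑ ^ 2 * ‖s‖ₑ ^ (-σ) := by
        rw [lintegral_add_left measurable_const, setLIntegral_const, hvol, mul_one,
          lintegral_const_mul' _ _ ENNReal.ofReal_ne_top]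
    _ ≤ _ := by
        rw [mul_assoc (ENNReal.ofReal (1 + ε⁻¹))]
        gcongr

theorem lintegral_ball_enorm_rpow_ne_top {σ : ℝ} (h1 : σ < 1) :
    ∫⁻ s in Metric.ball (0 : ℝ) 1, ‖s‖ₑ ^ (-σ) ≠ ⊤ := by
  have h : IntegrableOn (fun x : ℝ => |x| ^ (-σ)) (Metric.ball 0 1) := by
    refine integrableOn_ball_of_norm_le_rpow (C := 1) (α := σ) (by simp) (by simpa using h1)
      (Filter.Eventually.of_forall fun x => ?_)
      (Measurable.aestronglyMeasurable (by fun_prop))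
    simp [abs_of_nonneg (Real.rpow_nonneg (abs_nonneg x) _)]
  refine ne_of_eq_of_ne (lintegral_congr_ae ?_) h.hasFiniteIntegral.ne
  filter_upwards [ae_restrict_of_ae
    (compl_mem_ae_iff.2 (measure_singleton (μ := (volume : Measure ℝ)) 0))] with s hs
  have hs' : 0 < |s| := abs_pos.2 hs
  rw [← ofReal_norm, ← ofReal_norm, Real.norm_eq_abs, ENNReal.ofReal_rpow_of_pos hs',
    Real.norm_of_nonneg (by positivity)]

/-- Supplies the finiteness needed for absorption in `hardy_line`. The decay may be centred at `-c`,
away from the singularity, because the restriction of a function to a line is reparametrized so that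
the singularity sits at `0`. -/
theorem lintegral_enorm_sq_mul_rpow_ne_top {σ : ℝ} (h0 : 0 < σ) (h1 : σ < 1) {f : ℝ → ℂ} {D c : ℝ}
    (hf : ∀ s, ‖f s‖ ≤ D * (1 + |s + c|)⁻¹) :
    ∫⁻ s, ‖f s‖ₑ ^ 2 * ‖s‖ₑ ^ (-σ) ≠ ⊤ := by
  set B : ℝ → ℝ≥0∞ := fun s => ENNReal.ofReal (D ^ 2) *
    (ENNReal.ofReal ((1 + ‖s + c‖) ^ (-2 : ℝ)) +
      (Metric.ball (0 : ℝ) 1).indicator (fun s => ‖s‖ₑ ^ (-σ)) s) with hB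
  have hle : ∀ s, ‖f s‖ₑ ^ 2 * ‖s‖ₑ ^ (-σ) ≤ B s := by
    intro s
    have hq0 : 0 < (1 + |s + c|)⁻¹ := by positivity
    have hq : (1 + |s + c|)⁻¹ ≤ 1 := inv_le_one_of_one_le₀ (by linarith [abs_nonneg (s + c)])
    have hsq : ‖f s‖ ^ 2 ≤ D ^ 2 * (1 + |s + c|)⁻¹ ^ 2 := by
      rw [← mul_pow]
      gcongr
      exact hf s
    have e1 : ‖f s‖ₑ ^ 2 ≤ ENNReal.ofReal (D ^ 2 * (1 + |s + c|)⁻¹ ^ 2) := by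
      rw [← ofReal_norm, ← ENNReal.ofReal_pow (norm_nonneg _)]
      exact ENNReal.ofReal_le_ofReal hsq
    by_cases hs : s ∈ Metric.ball (0 : ℝ) 1
    · calc ‖f s‖ₑ ^ 2 * ‖s‖ₑ ^ (-σ) ≤ ENNReal.ofReal (D ^ 2) * ‖s‖ₑ ^ (-σ) := by
            gcongr
            refine e1.trans (ENNReal.ofReal_le_ofReal ?_)
            have : (1 + |s + c|)⁻¹ ^ 2 ≤ 1 := pow_le_one₀ hq0.le hq
            nlinarith [sq_nonneg D]
        _ ≤ B s := by
            rw [hB]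
            simp only [indicator_of_mem hs]
            gcongr
            exact le_add_self
    · have hs1 : 1 ≤ ‖s‖ₑ := by
        rw [← ofReal_norm, ENNReal.one_le_ofReal]
        simpa using hs
      have hone : ‖s‖ₑ ^ (-σ) ≤ 1 := by
        rw [ENNReal.rpow_neg]
        exact ENNReal.inv_le_one.2 (ENNReal.one_le_rpow hs1 h0)
      calc ‖f s‖ₑ ^ 2 * ‖s‖ₑ ^ (-σ) ≤ ENNReal.ofReal (D ^ 2 * (1 + |s + c|)⁻¹ ^ 2) * 1 := by
            gcongr
        _ = B s := by
            rw [hB]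
            simp only [indicator_of_notMem hs]
            rw [mul_one, add_zero, ENNReal.ofReal_mul (by positivity), Real.rpow_neg (by positivity),
              Real.rpow_two, Real.norm_eq_abs, inv_pow]
  refine ne_top_of_le_ne_top ?_ (lintegral_mono hle)
  rw [hB, lintegral_const_mul' _ _ ENNReal.ofReal_ne_top, lintegral_add_left (by fun_prop),
    lintegral_indicator Metric.isOpen_ball.measurableSet]
  refine ENNReal.mul_ne_top ENNReal.ofReal_ne_top (ENNReal.add_ne_top.2
    ⟨?_, lintegral_ball_enorm_rpow_ne_top h1⟩)
  have hi : Integrable (fun s : ℝ => (1 + ‖s‖) ^ (-2 : ℝ)) :=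
    integrable_one_add_norm (by simp)
  rw [lintegral_add_right_eq_self (fun s : ℝ => ENNReal.ofReal ((1 + ‖s‖) ^ (-2 : ℝ)))]
  exact hi.lintegral_lt_top.ne

/-! ### Hardy's inequality along parallel lines -/

section Lines

variable {V : Type*} [NormedAddCommGroup V] [NormedSpace ℝ V] [FiniteDimensional ℝ V]
  [MeasurableSpace V] [BorelSpace V] {μ : Measure V} [SFinite μ] [μ.IsAddRightInvariant]

/-- Fubini over the lines parallel to `e` without choosing a complement: a slab of width one in `ℓ`
meets every such line in a segment of parameter length one, so each line is counted with total mass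
one. -/
theorem lintegral_eq_lintegral_line {ℓ : V →L[ℝ] ℝ} {e : V} (he : ℓ e = 1) {F : V → ℝ≥0∞}
    (hF : Measurable F) :
    ∫⁻ p, (Icc (0 : ℝ) 1).indicator 1 (ℓ p) * (∫⁻ s : ℝ, F (p + s • e)) ∂μ = ∫⁻ p, F p ∂μ := by
  set ρ : ℝ → ℝ≥0∞ := (Icc (0 : ℝ) 1).indicator 1 with hρ
  have hρm : Measurable ρ := measurable_one.indicator measurableSet_Icc
  have hρ1 : ∫⁻ s, ρ s = 1 := by
    rw [hρ, lintegral_indicator_one measurableSet_Icc]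
    simp
  calc ∫⁻ p, ρ (ℓ p) * (∫⁻ s : ℝ, F (p + s • e)) ∂μ
      = ∫⁻ p, (∫⁻ s : ℝ, ρ (ℓ p) * F (p + s • e)) ∂μ := by
        refine lintegral_congr fun p => ?_
        rw [lintegral_const_mul _ (by fun_prop)]
    _ = ∫⁻ s : ℝ, ∫⁻ p, ρ (ℓ p) * F (p + s • e) ∂μ :=
        lintegral_lintegral_swap (Measurable.aemeasurable (by fun_prop))
    _ = ∫⁻ s : ℝ, ∫⁻ p, ρ (ℓ p - s) * F p ∂μ := by
        refine lintegral_congr fun s => ?_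
        rw [← lintegral_add_right_eq_self (fun p => ρ (ℓ p - s) * F p) (s • e)]
        simp [he]
    _ = ∫⁻ p, (∫⁻ s : ℝ, ρ (ℓ p - s)) * F p ∂μ := by
        rw [lintegral_lintegral_swap (Measurable.aemeasurable (by fun_prop))]
        refine lintegral_congr fun p => ?_
        rw [lintegral_mul_const _ (by fun_prop)]
    _ = _ := by
        refine lintegral_congr fun p => ?_
        rw [lintegral_sub_left_eq_self, hρ1, one_mul]

theorem lintegral_le_of_line {ℓ : V →L[ℝ] ℝ} {e : V} (he : ℓ e = 1) {F H : V → ℝ≥0∞}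
    (hF : Measurable F) (hH : Measurable H)
    (h : ∀ p, ∫⁻ s : ℝ, F (p + s • e) ≤ ∫⁻ s : ℝ, H (p + s • e)) :
    ∫⁻ p, F p ∂μ ≤ ∫⁻ p, H p ∂μ := by
  rw [← lintegral_eq_lintegral_line he hF, ← lintegral_eq_lintegral_line he hH]
  exact lintegral_mono fun p => mul_le_mul_right (h p) _

variable (μ) in
-- On each line parallel to `e` the shift `c` and the weight `W` are constants, so this is
-- `hardy_line` after translating the singularity to `0`. The weight `W` leaves room for a second
-- singularity in a transverse direction.
theorem hardy_direction {σ : ℝ} (h0 : 0 < σ) (h1 : σ < 1) : ∃ C : ℝ≥0∞, C ≠ ⊤ ∧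
    ∀ (ℓ : V →L[ℝ] ℝ) (e : V) (c : V → ℝ) (W : V → ℝ≥0∞) (f : V → ℂ) (D : ℝ), ℓ e = 1 →
      Measurable c → Measurable W → Measurable f → (∀ p (s : ℝ), c (p + s • e) = c p) →
      (∀ p (s : ℝ), W (p + s • e) = W p) → (∀ p, ‖f p‖ ≤ D * (1 + |ℓ p|)⁻¹) →
      ∫⁻ p, ‖f p‖ₑ ^ 2 * ‖ℓ p - c p‖ₑ ^ (-σ) * W p ∂μ ≤
        C * ∫⁻ h : ℝ, ‖h‖ₑ ^ (-1 - σ) * ∫⁻ p, ‖f (p + h • e) - f p‖ₑ ^ 2 * W p ∂μ := by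
  obtain ⟨C, hC, hardy⟩ := hardy_line h0 h1
  refine ⟨C, hC, fun ℓ e c W f D he hc hW hf hce hWe hfD => ?_⟩
  have hswap : ∫⁻ h : ℝ, ‖h‖ₑ ^ (-1 - σ) * ∫⁻ p, ‖f (p + h • e) - f p‖ₑ ^ 2 * W p ∂μ =
      ∫⁻ p, (∫⁻ h : ℝ, ‖h‖ₑ ^ (-1 - σ) * ‖f (p + h • e) - f p‖ₑ ^ 2 * W p) ∂μ := by
    rw [lintegral_lintegral_swap (Measurable.aemeasurable (by fun_prop))]
    refine lintegral_congr fun h => ?_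
    rw [← lintegral_const_mul _ (by fun_prop)]
    simp_rw [mul_assoc]
  rw [hswap, ← lintegral_const_mul _ (by fun_prop)]
  refine lintegral_le_of_line he (by fun_prop) (by fun_prop) fun p => ?_
  set a : ℝ := ℓ p - c p with ha
  set φ : ℝ → ℂ := fun s => f (p + (s - a) • e) with hφ
  have hφm : Measurable φ := by fun_prop
  have hφD : ∀ s, ‖φ s‖ ≤ D * (1 + |s + c p|)⁻¹ := by
    intro s
    refine (hfD _).trans_eq ?_
    simp only [map_add, map_smul, he, ha, smul_eq_mul, mul_one]
    rw [show ℓ p + (s - (ℓ p - c p)) = s + c p by ring]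
  have key := hardy φ hφm (lintegral_enorm_sq_mul_rpow_ne_top h0 h1 hφD)
  calc ∫⁻ s : ℝ, ‖f (p + s • e)‖ₑ ^ 2 * ‖ℓ (p + s • e) - c (p + s • e)‖ₑ ^ (-σ) * W (p + s • e)
      = ∫⁻ s : ℝ, (‖φ (s + a)‖ₑ ^ 2 * ‖s + a‖ₑ ^ (-σ)) * W p := by
        refine lintegral_congr fun s => ?_
        rw [hce, hWe]
        simp only [hφ, map_add, map_smul, he, smul_eq_mul, mul_one, add_sub_cancel_right]
        rw [ha, show ℓ p + s - c p = s + (ℓ p - c p) by ring]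
    _ = (∫⁻ s : ℝ, ‖φ s‖ₑ ^ 2 * ‖s‖ₑ ^ (-σ)) * W p := by
        rw [lintegral_mul_const _ (by fun_prop),
          lintegral_add_right_eq_self (fun s : ℝ => ‖φ s‖ₑ ^ 2 * ‖s‖ₑ ^ (-σ))]
    _ ≤ (C * ∫⁻ s, ∫⁻ h, ‖h‖ₑ ^ (-1 - σ) * ‖φ (s + h) - φ s‖ₑ ^ 2) * W p := by gcongr
    _ = C * ∫⁻ s : ℝ, ∫⁻ h : ℝ, ‖h‖ₑ ^ (-1 - σ) * ‖φ (s + a + h) - φ (s + a)‖ₑ ^ 2 * W p := by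
        rw [mul_assoc, ← lintegral_mul_const _ (by fun_prop),
          ← lintegral_add_right_eq_self (fun s : ℝ =>
            (∫⁻ h, ‖h‖ₑ ^ (-1 - σ) * ‖φ (s + h) - φ s‖ₑ ^ 2) * W p) a]
        congr 1
        refine lintegral_congr fun s => ?_
        rw [lintegral_mul_const _ (by fun_prop)]
    _ = ∫⁻ s : ℝ, C * ∫⁻ h : ℝ, ‖h‖ₑ ^ (-1 - σ) * ‖f (p + s • e + h • e) - f (p + s • e)‖ₑ ^ 2 *
          W (p + s • e) := by
        rw [← lintegral_const_mul _ (by fun_prop)]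
        refine lintegral_congr fun s => ?_
        simp only [hφ, hWe, add_sub_cancel_right, add_assoc p, ← add_smul]
        congr 1
        refine lintegral_congr fun h => ?_
        rw [show s + a + h - a = s + h by ring]

end Lines

/-! ### The difference seminorm on the Fourier side -/

theorem enorm_exp_sub_one_sq_le (x : ℝ) :
    ‖Complex.exp (x * Complex.I) - 1‖ₑ ^ 2 ≤ min 4 (‖x‖ₑ ^ 2) := by
  refine le_min ?_ ?_
  · have h : ‖Complex.exp (x * Complex.I) - 1‖ₑ ≤ 2 := by
      refine (enorm_sub_le).trans ?_
      rw [← ofReal_norm, Complex.norm_exp_ofReal_mul_I, enorm_one, ENNReal.ofReal_one]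
      norm_num
    calc _ ≤ (2 : ℝ≥0∞) ^ 2 := by gcongr
      _ = 4 := by norm_num
  · gcongr
    rw [← ofReal_norm, ← ofReal_norm]
    refine ENNReal.ofReal_le_ofReal ?_
    simpa [mul_comm] using Real.norm_exp_I_mul_ofReal_sub_one_le (x := x)

theorem lintegral_min_mul_rpow_ne_top {σ : ℝ} (h0 : 0 < σ) (h1 : σ < 1) :
    ∫⁻ h : ℝ, ‖h‖ₑ ^ (-1 - σ) * min 4 (‖h‖ₑ ^ 2) ≠ ⊤ := by
  set B : ℝ → ℝ≥0∞ := fun s => ENNReal.ofReal (4 * 2 ^ (1 + σ)) *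
    ENNReal.ofReal ((1 + ‖s‖) ^ (-(1 + σ))) +
      (Metric.ball (0 : ℝ) 1).indicator (fun s => ‖s‖ₑ ^ (-σ)) s with hB
  have hle : ∀ s : ℝ, s ≠ 0 → ‖s‖ₑ ^ (-1 - σ) * min 4 (‖s‖ₑ ^ 2) ≤ B s := by
    intro s hs0
    have hs' : 0 < |s| := abs_pos.2 hs0
    by_cases hs : s ∈ Metric.ball (0 : ℝ) 1
    · have hs1 : |s| < 1 := by simpa using hs
      calc ‖s‖ₑ ^ (-1 - σ) * min 4 (‖s‖ₑ ^ 2) ≤ ‖s‖ₑ ^ (-1 - σ) * ‖s‖ₑ ^ 2 := by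
            gcongr
            exact min_le_right _ _
        -- The true exponent is `1 - σ`; it is weakened to `-σ`, which is still integrable near `0`
        -- and already treated.
        _ ≤ ‖s‖ₑ ^ (-σ) := by
            rw [← ofReal_norm, Real.norm_eq_abs, ENNReal.ofReal_rpow_of_pos hs',
              ENNReal.ofReal_rpow_of_pos hs', ← ENNReal.ofReal_pow hs'.le,
              ← ENNReal.ofReal_mul (by positivity)]
            refine ENNReal.ofReal_le_ofReal ?_
            rw [← Real.rpow_natCast, ← Real.rpow_add hs']
            exact Real.rpow_le_rpow_of_exponent_ge hs' hs1.le (by norm_num; linarith)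
        _ ≤ B s := by
            rw [hB]
            simp only [indicator_of_mem hs]
            exact le_add_self
    · have hs1 : 1 ≤ |s| := by simpa using hs
      calc ‖s‖ₑ ^ (-1 - σ) * min 4 (‖s‖ₑ ^ 2) ≤ ‖s‖ₑ ^ (-1 - σ) * 4 := by
            gcongr
            exact min_le_left _ _
        _ ≤ B s := by
            rw [hB]
            simp only [indicator_of_notMem hs]
            rw [add_zero, ← ofReal_norm, Real.norm_eq_abs, ENNReal.ofReal_rpow_of_pos hs',
              ← ENNReal.ofReal_mul (by positivity), ← ENNReal.ofReal_ofNat 4,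
              ← ENNReal.ofReal_mul (by positivity)]
            refine ENNReal.ofReal_le_ofReal ?_
            have h2 : (2 * |s|) ^ (-(1 + σ)) ≤ (1 + |s|) ^ (-(1 + σ)) :=
              Real.rpow_le_rpow_of_nonpos (by positivity) (by linarith) (by linarith)
            rw [Real.mul_rpow (by norm_num) hs'.le] at h2
            have h6 : (2 : ℝ) ^ (1 + σ) * 2 ^ (-(1 + σ)) = 1 := by
              rw [← Real.rpow_add (by norm_num)]
              simp
            calc |s| ^ (-1 - σ) * 4 = 4 * 2 ^ (1 + σ) * (2 ^ (-(1 + σ)) * |s| ^ (-(1 + σ))) := by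
                  rw [show -1 - σ = -(1 + σ) by ring]
                  linear_combination (-(4 * |s| ^ (-(1 + σ)))) * h6
              _ ≤ _ := by gcongr
  have hae : ∀ᵐ s : ℝ, ‖s‖ₑ ^ (-1 - σ) * min 4 (‖s‖ₑ ^ 2) ≤ B s := by
    filter_upwards [compl_mem_ae_iff.2 (measure_singleton (μ := (volume : Measure ℝ)) 0)]
      with s hs using hle s hs
  refine ne_top_of_le_ne_top ?_ (lintegral_mono_ae hae)
  rw [hB, lintegral_add_left (by fun_prop), lintegral_const_mul' _ _ ENNReal.ofReal_ne_top,
    lintegral_indicator Metric.isOpen_ball.measurableSet]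
  refine ENNReal.add_ne_top.2 ⟨ENNReal.mul_ne_top ENNReal.ofReal_ne_top ?_,
    lintegral_ball_enorm_rpow_ne_top h1⟩
  have hi : Integrable (fun s : ℝ => (1 + ‖s‖) ^ (-(1 + σ))) :=
    integrable_one_add_norm (by simpa using h0)
  exact hi.lintegral_lt_top.ne

/-- The kernel `|h| ^ (-1 - σ)` is homogeneous, so substituting `y * h` for `h` extracts exactly
`|y| ^ σ`. -/
theorem lintegral_exp_sub_one_le (σ y : ℝ) :
    ∫⁻ h : ℝ, ‖h‖ₑ ^ (-1 - σ) * ‖Complex.exp ((y * h : ℝ) * Complex.I) - 1‖ₑ ^ 2 ≤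
      (∫⁻ h : ℝ, ‖h‖ₑ ^ (-1 - σ) * min 4 (‖h‖ₑ ^ 2)) * ‖y‖ₑ ^ σ := by
  rcases eq_or_ne y 0 with rfl | hy
  · simp
  have hy' : 0 < |y| := abs_pos.2 hy
  have e : ∀ h : ℝ, ‖h‖ₑ ^ (-1 - σ) * min 4 (‖y * h‖ₑ ^ 2) =
      ENNReal.ofReal (|y| ^ (1 + σ)) * (‖y * h‖ₑ ^ (-1 - σ) * min 4 (‖y * h‖ₑ ^ 2)) := by
    intro h
    rw [enorm_mul, ENNReal.mul_rpow_of_ne_top enorm_ne_top enorm_ne_top, ← mul_assoc, ← mul_assoc,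
      ← ofReal_norm y, Real.norm_eq_abs, ENNReal.ofReal_rpow_of_pos hy',
      ← ENNReal.ofReal_mul (by positivity), ← Real.rpow_add hy']
    simp
  calc _ ≤ ∫⁻ h : ℝ, ‖h‖ₑ ^ (-1 - σ) * min 4 (‖y * h‖ₑ ^ 2) := by
        gcongr
        exact enorm_exp_sub_one_sq_le _
    _ = _ := by
        simp_rw [e]
        rw [lintegral_const_mul' _ _ ENNReal.ofReal_ne_top,
          lintegral_comp_const_mul hy (fun h => ‖h‖ₑ ^ (-1 - σ) * min 4 (‖h‖ₑ ^ 2)), ← mul_assoc,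
          ← ENNReal.ofReal_mul (by positivity), mul_comm, ← ofReal_norm y, Real.norm_eq_abs,
          ENNReal.ofReal_rpow_of_pos hy', abs_inv, ← Real.rpow_neg_one, ← Real.rpow_add hy']
        ring_nf

/-! ### Multidimensional fractional Hardy inequalities -/

section Schwartz

variable {V : Type*} [NormedAddCommGroup V] [InnerProductSpace ℝ V]

/-- The difference `p ↦ f (p + v) - f p` of a Schwartz function. -/
noncomputable def schwartzDiff (f : 𝓢(V, ℂ)) (v : V) : 𝓢(V, ℂ) :=
  SchwartzMap.compSubConstCLM ℂ (-v) f - f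

theorem schwartzDiff_apply (f : 𝓢(V, ℂ)) (v p : V) : schwartzDiff f v p = f (p + v) - f p := by
  simp [schwartzDiff]

theorem exists_norm_le_mul_inv (f : 𝓢(V, ℂ)) (ℓ : V →L[ℝ] ℝ) :
    ∃ D : ℝ, ∀ p, ‖f p‖ ≤ D * (1 + |ℓ p|)⁻¹ := by
  refine ⟨(1 + ‖ℓ‖) *
    (2 ^ 1 * ((Finset.Iic (1, 0)).sup (schwartzSeminormFamily ℂ V ℂ)) f), fun p => ?_⟩
  have h := SchwartzMap.one_add_le_sup_seminorm_apply (𝕜 := ℂ) (m := (1, 0)) (k := 1) (n := 0)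
    le_rfl le_rfl f p
  rw [norm_iteratedFDeriv_zero, pow_one] at h
  have h2 : |ℓ p| ≤ ‖ℓ‖ * ‖p‖ := ℓ.le_opNorm p
  rw [← div_eq_mul_inv, le_div_iff₀ (by positivity)]
  calc ‖f p‖ * (1 + |ℓ p|) ≤ ‖f p‖ * ((1 + ‖ℓ‖) * (1 + ‖p‖)) := by
        gcongr
        nlinarith [norm_nonneg ℓ, norm_nonneg p]
    _ = (1 + ‖ℓ‖) * ((1 + ‖p‖) * ‖f p‖) := by ring
    _ ≤ _ := mul_le_mul_of_nonneg_left h (by positivity)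

variable [FiniteDimensional ℝ V] [MeasurableSpace V] [BorelSpace V]

theorem fourier_schwartzDiff (f : 𝓢(V, ℂ)) (v x : V) :
    𝓕 (schwartzDiff f v) x =
      (Complex.exp ((2 * Real.pi * inner ℝ v x : ℝ) * Complex.I) - 1) * 𝓕 f x := by
  have h1 : 𝓕 (SchwartzMap.compSubConstCLM ℂ (-v) f) x =
      Complex.exp ((2 * Real.pi * inner ℝ v x : ℝ) * Complex.I) * 𝓕 f x := by
    have := congrFun (VectorFourier.fourierIntegral_comp_add_right Real.fourierChar
      (volume : Measure V) (innerₗ V) (f : V → ℂ) v) x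
    rw [SchwartzMap.fourier_coe, SchwartzMap.fourier_coe]
    have hc : (⇑(SchwartzMap.compSubConstCLM ℂ (-v) f) : V → ℂ) = f ∘ fun w => w + v := by
      ext w; simp
    rw [hc]
    refine this.trans ?_
    simp only [innerₗ_apply_apply, Circle.smul_def, Real.fourierChar_apply, smul_eq_mul]
    rfl
  rw [schwartzDiff, sub_eq_add_neg, FourierTransform.fourier_add,
    FourierTransform.fourier_neg, add_apply, neg_apply, h1]
  ring

theorem lintegral_enorm_sq_fourier (f : 𝓢(V, ℂ)) :
    ∫⁻ x, ‖𝓕 f x‖ₑ ^ 2 = ∫⁻ x, ‖f x‖ₑ ^ 2 := by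
  have h : ∀ g : 𝓢(V, ℂ), ∫⁻ x, ‖g x‖ₑ ^ 2 = ENNReal.ofReal (∫ x, ‖g x‖ ^ 2) := by
    intro g
    rw [ofReal_integral_eq_lintegral_ofReal]
    · refine lintegral_congr fun x => ?_
      rw [← ofReal_norm, ENNReal.ofReal_pow (norm_nonneg _)]
    · exact (memLp_two_iff_integrable_sq_norm g.continuous.aestronglyMeasurable).1 (g.memLp 2)
    · exact Filter.Eventually.of_forall fun x => by positivity
  rw [h, h, SchwartzMap.integral_norm_sq_fourier]

theorem lintegral_lintegral_exp_sub_one_le (σ : ℝ) (e : V) {Φ : V → ℝ≥0∞}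
    (hΦ : Measurable Φ) :
    ∫⁻ h : ℝ, ‖h‖ₑ ^ (-1 - σ) * ∫⁻ x,
      ‖Complex.exp ((2 * Real.pi * inner ℝ (h • e) x : ℝ) * Complex.I) - 1‖ₑ ^ 2 * Φ x ≤
    (∫⁻ h : ℝ, ‖h‖ₑ ^ (-1 - σ) * min 4 (‖h‖ₑ ^ 2)) *
      ∫⁻ x, ‖2 * Real.pi * inner ℝ e x‖ₑ ^ σ * Φ x := by
  have e1 : ∀ (h : ℝ) (x : V), 2 * Real.pi * inner ℝ (h • e) x =
      2 * Real.pi * inner ℝ e x * h := by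
    intro h x
    rw [real_inner_smul_left]
    ring
  simp_rw [e1]
  calc _ = ∫⁻ h : ℝ, ∫⁻ x, ‖h‖ₑ ^ (-1 - σ) *
        ‖Complex.exp ((2 * Real.pi * inner ℝ e x * h : ℝ) * Complex.I) - 1‖ₑ ^ 2 * Φ x := by
        refine lintegral_congr fun h => ?_
        rw [← lintegral_const_mul _ (by fun_prop)]
        simp_rw [mul_assoc]
    _ = ∫⁻ x, (∫⁻ h : ℝ, ‖h‖ₑ ^ (-1 - σ) *
        ‖Complex.exp ((2 * Real.pi * inner ℝ e x * h : ℝ) * Complex.I) - 1‖ₑ ^ 2) * Φ x := by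
        rw [lintegral_lintegral_swap (Measurable.aemeasurable (by fun_prop))]
        refine lintegral_congr fun x => ?_
        rw [lintegral_mul_const _ (by fun_prop)]
    _ ≤ ∫⁻ x, ((∫⁻ h : ℝ, ‖h‖ₑ ^ (-1 - σ) * min 4 (‖h‖ₑ ^ 2)) *
          ‖2 * Real.pi * inner ℝ e x‖ₑ ^ σ) * Φ x := by
        refine lintegral_mono fun x => ?_
        gcongr
        exact lintegral_exp_sub_one_le _ _
    _ = _ := by
        simp_rw [mul_assoc]
        rw [lintegral_const_mul _ (by fun_prop)]

/-- By Plancherel each difference becomes multiplication by `e^{2πi h⟨e,x⟩} - 1`; integrating in `h`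
first yields `|2π⟨e,x⟩|^σ`. -/
theorem lintegral_schwartzDiff_le (σ : ℝ) (e : V) (f : 𝓢(V, ℂ)) :
    ∫⁻ h : ℝ, ‖h‖ₑ ^ (-1 - σ) * ∫⁻ p, ‖schwartzDiff f (h • e) p‖ₑ ^ 2 ≤
    (∫⁻ h : ℝ, ‖h‖ₑ ^ (-1 - σ) * min 4 (‖h‖ₑ ^ 2)) *
      ∫⁻ x, ‖2 * Real.pi * inner ℝ e x‖ₑ ^ σ * ‖𝓕 f x‖ₑ ^ 2 := by
  refine le_trans (le_of_eq ?_) (lintegral_lintegral_exp_sub_one_le σ e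
    (Φ := fun x => ‖𝓕 f x‖ₑ ^ 2) (by have := (𝓕 f).continuous; fun_prop))
  simp_rw [← lintegral_enorm_sq_fourier (schwartzDiff f _), fourier_schwartzDiff, enorm_mul,
    mul_pow]

variable (V) in
theorem fractional_hardy {σ : ℝ} (h0 : 0 < σ) (h1 : σ < 1) : ∃ C : ℝ≥0∞, C ≠ ⊤ ∧
    ∀ (ℓ : V →L[ℝ] ℝ) (e : V) (c : V → ℝ) (f : 𝓢(V, ℂ)), ℓ e = 1 →
      Measurable c → (∀ p (s : ℝ), c (p + s • e) = c p) →
      ∫⁻ p, ‖f p‖ₑ ^ 2 * ‖ℓ p - c p‖ₑ ^ (-σ) ≤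
        C * ∫⁻ x, ‖2 * Real.pi * inner ℝ e x‖ₑ ^ σ * ‖𝓕 f x‖ₑ ^ 2 := by
  obtain ⟨C, hC, hardy⟩ := hardy_direction (volume : Measure V) h0 h1
  refine ⟨C * ∫⁻ h : ℝ, ‖h‖ₑ ^ (-1 - σ) * min 4 (‖h‖ₑ ^ 2),
    ENNReal.mul_ne_top hC (lintegral_min_mul_rpow_ne_top h0 h1), fun ℓ e c f he hc hce => ?_⟩
  obtain ⟨D, hD⟩ := exists_norm_le_mul_inv f ℓ
  have key := hardy ℓ e c 1 f D he hc measurable_one f.continuous.measurable hce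
    (fun _ _ => rfl) hD
  simp only [Pi.one_apply, mul_one, ← schwartzDiff_apply] at key
  refine key.trans ?_
  rw [mul_assoc]
  gcongr
  exact lintegral_schwartzDiff_le σ e f

variable (V) in
-- Hardy along `e` comes first, with the second singularity as an invariant weight; the resulting
-- differences are again Schwartz, and `fractional_hardy` along `e'` applies to each. In this order
-- `c` may vary along `e'`, which is needed because the zero hyperplane of `Im P_z` is sheared by
-- `a`.
theorem fractional_hardy_two {σ : ℝ} (h0 : 0 < σ) (h1 : σ < 1) : ∃ C : ℝ≥0∞, C ≠ ⊤ ∧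
    ∀ (ℓ ℓ' : V →L[ℝ] ℝ) (e e' : V) (c c' : V → ℝ) (f : 𝓢(V, ℂ)), ℓ e = 1 → ℓ' e' = 1 → ℓ' e = 0 →
      Measurable c → Measurable c' → (∀ p (s : ℝ), c (p + s • e) = c p) →
      (∀ p (s : ℝ), c' (p + s • e) = c' p) → (∀ p (s : ℝ), c' (p + s • e') = c' p) →
      ∫⁻ p, ‖f p‖ₑ ^ 2 * ‖ℓ p - c p‖ₑ ^ (-σ) * ‖ℓ' p - c' p‖ₑ ^ (-σ) ≤
        C * ∫⁻ x, ‖2 * Real.pi * inner ℝ e x‖ₑ ^ σ *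
          (‖2 * Real.pi * inner ℝ e' x‖ₑ ^ σ * ‖𝓕 f x‖ₑ ^ 2) := by
  obtain ⟨C, hC, hardy⟩ := hardy_direction (volume : Measure V) h0 h1
  obtain ⟨C', hC', hardy'⟩ := fractional_hardy V h0 h1
  set K := ∫⁻ h : ℝ, ‖h‖ₑ ^ (-1 - σ) * min 4 (‖h‖ₑ ^ 2) with hK
  refine ⟨C * (C' * K), ENNReal.mul_ne_top hC (ENNReal.mul_ne_top hC'
    (lintegral_min_mul_rpow_ne_top h0 h1)),
    fun ℓ ℓ' e e' c c' f he he' hee hc hc' hce hce' hce'' => ?_⟩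
  obtain ⟨D, hD⟩ := exists_norm_le_mul_inv f ℓ
  have hfm := (𝓕 f).continuous.measurable
  have key := hardy ℓ e c (fun p => ‖ℓ' p - c' p‖ₑ ^ (-σ)) f D he hc (by fun_prop)
    f.continuous.measurable hce (fun p s => by simp [hee, hce']) hD
  refine key.trans ?_
  rw [mul_assoc]
  gcongr C * ?_
  calc ∫⁻ h : ℝ, ‖h‖ₑ ^ (-1 - σ) * ∫⁻ p, ‖f (p + h • e) - f p‖ₑ ^ 2 * ‖ℓ' p - c' p‖ₑ ^ (-σ)
      ≤ ∫⁻ h : ℝ, ‖h‖ₑ ^ (-1 - σ) * (C' * ∫⁻ x, ‖2 * Real.pi * inner ℝ e' x‖ₑ ^ σ *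
          ‖𝓕 (schwartzDiff f (h • e)) x‖ₑ ^ 2) := by
        gcongr with h
        have := hardy' ℓ' e' c' (schwartzDiff f (h • e)) he' hc' hce''
        simpa only [schwartzDiff_apply] using this
    _ = C' * ∫⁻ h : ℝ, ‖h‖ₑ ^ (-1 - σ) * ∫⁻ x,
          ‖Complex.exp ((2 * Real.pi * inner ℝ (h • e) x : ℝ) * Complex.I) - 1‖ₑ ^ 2 *
            (‖2 * Real.pi * inner ℝ e' x‖ₑ ^ σ * ‖𝓕 f x‖ₑ ^ 2) := by
        rw [← lintegral_const_mul' _ _ hC']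
        refine lintegral_congr fun h => ?_
        simp_rw [fourier_schwartzDiff, enorm_mul, mul_pow]
        rw [mul_left_comm]
        simp_rw [mul_left_comm]
    _ ≤ _ := by
        rw [mul_assoc]
        gcongr
        exact lintegral_lintegral_exp_sub_one_le σ e (by fun_prop)

end Schwartz

/-! ### Splitting the singularity on the sphere into coordinate singularities -/

/-- The nonnegative `j`-th coordinate of the points of the sphere of radius `β` whose other
coordinates agree with those of `y`. -/
noncomputable def sphereRoot {n : ℕ} (β : ℝ) (j : Fin n) (y : EuclideanSpace ℝ (Fin n)) : ℝ :=
  √(β ^ 2 - (‖y‖ ^ 2 - y j ^ 2))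

theorem continuous_sphereRoot {n : ℕ} (β : ℝ) (j : Fin n) : Continuous (sphereRoot β j) := by
  unfold sphereRoot
  fun_prop

theorem sphereRoot_add_single {n : ℕ} (β : ℝ) (j : Fin n) (y : EuclideanSpace ℝ (Fin n)) (s : ℝ) :
    sphereRoot β j (y + s • EuclideanSpace.single j 1) = sphereRoot β j y := by
  unfold sphereRoot
  congr 2
  rw [@norm_add_sq_real, norm_smul, real_inner_smul_right, EuclideanSpace.inner_single_right]
  simp
  ring

/-- Pigeonhole; dividing by `n + 1` rather than `n` makes the contradiction strict. -/
theorem exists_sq_coord_ge {n : ℕ} {y : EuclideanSpace ℝ (Fin n)} (hy : y ≠ 0) :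
    ∃ j, ‖y‖ ^ 2 / (n + 1) ≤ y j ^ 2 := by
  by_contra! h
  have h1 : ‖y‖ ^ 2 ≤ ∑ _j : Fin n, ‖y‖ ^ 2 / (n + 1) := by
    rw [EuclideanSpace.real_norm_sq_eq y]
    exact Finset.sum_le_sum fun j _ => by
      have := (h j).le
      rwa [EuclideanSpace.real_norm_sq_eq y] at this
  have hpos : 0 < ‖y‖ ^ 2 := by positivity
  simp only [Finset.sum_const, Finset.card_univ, Fintype.card_fin, nsmul_eq_mul] at h1
  rw [mul_div_assoc', le_div_iff₀ (by positivity)] at h1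
  nlinarith

/-- With `c` the root, `r² - c²` factors as `(r - c)(r + c)`, and the factor whose two terms have
equal sign is at least `|r|` in size. If `s > β²` the root is `0` by convention and the claim is `r²
≤ r² + s - β²`. -/
theorem mul_min_le_abs_sq_sub_sq {r s β : ℝ} :
    |r| * min |r - √(β ^ 2 - s)| |r + √(β ^ 2 - s)| ≤ |r ^ 2 + s - β ^ 2| := by
  rcases le_total s (β ^ 2) with h | h
  · set c := √(β ^ 2 - s) with hc
    have hc2 : c ^ 2 = β ^ 2 - s := Real.sq_sqrt (by linarith)
    have hc0 : 0 ≤ c := Real.sqrt_nonneg _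
    have e : r ^ 2 + s - β ^ 2 = (r - c) * (r + c) := by linear_combination hc2
    rw [e, abs_mul]
    rcases le_total 0 r with hr | hr
    · have h1 : |r| ≤ |r + c| := by
        rw [abs_of_nonneg hr, abs_of_nonneg (by positivity)]
        linarith
      rw [mul_comm]
      exact mul_le_mul (min_le_left _ _) h1 (abs_nonneg _) (abs_nonneg _)
    · have h1 : |r| ≤ |r - c| := by
        rw [abs_of_nonpos hr, abs_of_nonpos (by linarith)]
        linarith
      exact mul_le_mul h1 (min_le_right _ _) (le_min (abs_nonneg _) (abs_nonneg _)) (abs_nonneg _)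
  · rw [Real.sqrt_eq_zero_of_nonpos (by linarith), sub_zero, add_zero, min_self,
      abs_mul_abs_self, abs_of_nonneg (by nlinarith [sq_nonneg r])]
    nlinarith

theorem rpow_neg_antitone {σ : ℝ} (hσ : 0 < σ) {a b : ℝ≥0∞} (h : a ≤ b) :
    b ^ (-σ) ≤ a ^ (-σ) := by
  rw [ENNReal.rpow_neg, ENNReal.rpow_neg]
  exact ENNReal.inv_le_inv.2 (ENNReal.rpow_le_rpow h hσ.le)

theorem enorm_rpow_neg_le {κ σ a b : ℝ} (hκ : 0 < κ) (hσ : 0 < σ) (h : κ * |b| ≤ |a|) :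
    ‖a‖ₑ ^ (-σ) ≤ ENNReal.ofReal κ ^ (-σ) * ‖b‖ₑ ^ (-σ) := by
  rw [← ENNReal.mul_rpow_of_ne_top ENNReal.ofReal_ne_top enorm_ne_top]
  refine rpow_neg_antitone hσ ?_
  rw [← ofReal_norm, ← ofReal_norm, ← ENNReal.ofReal_mul hκ.le]
  exact ENNReal.ofReal_le_ofReal h

theorem exists_enorm_sq_sub_sq_rpow_le (n : ℕ) {R σ : ℝ} (hR : 0 < R) (hσ : 0 < σ) :
    ∃ K : ℝ≥0∞, K ≠ ⊤ ∧ ∀ (β : ℝ) (y : EuclideanSpace ℝ (Fin n)), R ≤ β →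
      ‖‖y‖ ^ 2 - β ^ 2‖ₑ ^ (-σ) ≤ K * (1 + ∑ j, (‖y j - sphereRoot β j y‖ₑ ^ (-σ) +
        ‖y j + sphereRoot β j y‖ₑ ^ (-σ))) := by
  -- The first entry serves points where `|‖y‖² - β²|` is at least `3R²/4`. Otherwise `‖y‖² ≥ R²/4`,
  -- so some coordinate is at least the second entry in size.
  set κ : ℝ := min (3 / 4 * R ^ 2) (R / (2 * √(n + 1))) with hκ
  have hκ0 : 0 < κ := lt_min (by positivity) (by positivity)
  have hKtop : ENNReal.ofReal κ ^ (-σ) ≠ ⊤ := by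
    rw [ENNReal.rpow_neg]
    exact ENNReal.inv_ne_top.2
      (ENNReal.rpow_pos (ENNReal.ofReal_pos.2 hκ0) ENNReal.ofReal_ne_top).ne'
  refine ⟨ENNReal.ofReal κ ^ (-σ), hKtop, fun β y hβ => ?_⟩
  have hβ0 : 0 < β := hR.trans_le hβ
  by_cases hA : 3 / 4 * R ^ 2 ≤ |‖y‖ ^ 2 - β ^ 2|
  · have h := enorm_rpow_neg_le (κ := κ) (a := ‖y‖ ^ 2 - β ^ 2) (b := 1) hκ0 hσ
      (by rw [abs_one, mul_one]; exact (min_le_left _ _).trans hA)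
    rw [enorm_one, ENNReal.one_rpow] at h
    refine h.trans ?_
    gcongr
    exact le_self_add
  · push Not at hA
    have hy2 : R ^ 2 / 4 ≤ ‖y‖ ^ 2 := by
      have := neg_abs_le (‖y‖ ^ 2 - β ^ 2)
      nlinarith
    have hy : y ≠ 0 := by
      rintro rfl
      rw [norm_zero] at hy2
      nlinarith
    obtain ⟨j, hj⟩ := exists_sq_coord_ge hy
    have hjR : R / (2 * √(n + 1)) ≤ |y j| := by
      rw [← sq_le_sq₀ (by positivity) (abs_nonneg _), sq_abs, div_pow, mul_pow,
        Real.sq_sqrt (by positivity)]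
      refine le_trans ?_ hj
      rw [div_le_div_iff₀ (by positivity) (by positivity)]
      have : (0 : ℝ) < n + 1 := by positivity
      nlinarith
    have hmin := mul_min_le_abs_sq_sub_sq (r := y j) (s := ‖y‖ ^ 2 - y j ^ 2) (β := β)
    rw [show y j ^ 2 + (‖y‖ ^ 2 - y j ^ 2) - β ^ 2 = ‖y‖ ^ 2 - β ^ 2 by ring] at hmin
    change |y j| * min |y j - sphereRoot β j y| |y j + sphereRoot β j y| ≤ _ at hmin
    have hterm : ‖‖y‖ ^ 2 - β ^ 2‖ₑ ^ (-σ) ≤ ENNReal.ofReal κ ^ (-σ) *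
        (‖y j - sphereRoot β j y‖ₑ ^ (-σ) + ‖y j + sphereRoot β j y‖ₑ ^ (-σ)) := by
      have hκj : κ ≤ |y j| := (min_le_right _ _).trans hjR
      rcases min_choice |y j - sphereRoot β j y| |y j + sphereRoot β j y| with h | h <;>
        rw [h] at hmin
      · refine (enorm_rpow_neg_le hκ0 hσ (le_trans (by gcongr) hmin)).trans ?_
        gcongr
        exact le_self_add
      · refine (enorm_rpow_neg_le hκ0 hσ (le_trans (by gcongr) hmin)).trans ?_
        gcongr
        exact le_add_self
    refine hterm.trans ?_
    refine mul_le_mul_right (le_trans ?_ le_add_self) _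
    exact Finset.single_le_sum (f := fun j => ‖y j - sphereRoot β j y‖ₑ ^ (-σ) +
      ‖y j + sphereRoot β j y‖ₑ ^ (-σ)) (fun _ _ => zero_le) (Finset.mem_univ j)

/-! ### The weighted estimate for powers of `1 / P_z` -/

/-- The unit vector in the direction of the time axis. -/
noncomputable def timeDir (n : ℕ) : SpaceTime n := WithLp.toLp 2 (0, 1)

/-- The unit vector in the direction of the `j`-th space axis. -/
noncomputable def spaceDir {n : ℕ} (j : Fin n) : SpaceTime n :=
  WithLp.toLp 2 (EuclideanSpace.single j 1, 0)

theorem inner_timeDir {n : ℕ} (p : SpaceTime n) : inner ℝ (timeDir n) p = p.snd := by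
  simp [timeDir, WithLp.prod_inner_apply]

theorem inner_spaceDir {n : ℕ} (j : Fin n) (p : SpaceTime n) :
    inner ℝ (spaceDir j) p = p.fst j := by
  simp [spaceDir, WithLp.prod_inner_apply, EuclideanSpace.inner_single_left]

/-- The multiplier `1 / P_z` in the frequency variable of Mathlib's Fourier transform. -/
noncomputable def invSymbol {n : ℕ} (z : Fin n → ℂ) (k : SpaceTime n) : ℂ :=
  (symbol z ((2 * Real.pi) • k))⁻¹

theorem measurable_invSymbol {n : ℕ} (z : Fin n → ℂ) : Measurable (invSymbol z) :=
  ((continuous_symbol z).measurable.comp (measurable_const_smul _)).inv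

/-- The weight `1 + |x|² + t²`. -/
noncomputable def weight {n : ℕ} (p : SpaceTime n) : ℝ := 1 + ‖p.fst‖ ^ 2 + p.snd ^ 2

theorem one_le_weight {n : ℕ} (p : SpaceTime n) : 1 ≤ weight p := by
  unfold weight
  nlinarith [sq_nonneg ‖p.fst‖, sq_nonneg p.snd]

theorem weight_pos {n : ℕ} (p : SpaceTime n) : 0 < weight p :=
  zero_lt_one.trans_le (one_le_weight p)

theorem enorm_invSymbol_rpow_le {n : ℕ} (z : Fin n → ℂ) {σ : ℝ} (hσ : 0 < σ) (k : SpaceTime n) :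
    ‖invSymbol z k‖ₑ ^ (2 * σ) ≤ ‖k.snd - (-(2 * ∑ j, (z j).re * k.fst j))‖ₑ ^ (-σ) *
      ‖‖k.fst + (2 * Real.pi)⁻¹ • imVec z‖ ^ 2 - ((2 * Real.pi)⁻¹ * ‖imVec z‖) ^ 2‖ₑ ^ (-σ) := by
  set w := symbol z ((2 * Real.pi) • k) with hw
  set v := k.snd - (-(2 * ∑ j, (z j).re * k.fst j)) with hv
  set A := ‖k.fst + (2 * Real.pi)⁻¹ • imVec z‖ ^ 2 - ((2 * Real.pi)⁻¹ * ‖imVec z‖) ^ 2 with hA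
  have hpi := Real.pi_gt_three
  have him : w.im = -(2 * Real.pi * v) := by
    rw [hw, symbol_im, hv, sub_neg_eq_add]
    simp only [WithLp.smul_snd, WithLp.smul_fst, PiLp.smul_apply, smul_eq_mul]
    have : ∑ j, (z j).re * (2 * Real.pi * k.fst j) = 2 * Real.pi * ∑ j, (z j).re * k.fst j := by
      rw [Finset.mul_sum]
      exact Finset.sum_congr rfl fun j _ => by ring
    rw [this]
    ring
  have hre : w.re = (2 * Real.pi) ^ 2 * A := by
    rw [hw, symbol_re, hA]
    have e : ((2 * Real.pi) • k).fst + imVec z =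
        (2 * Real.pi) • (k.fst + (2 * Real.pi)⁻¹ • imVec z) := by
      rw [smul_add, smul_inv_smul₀ (by positivity)]
      rfl
    rw [e, norm_smul, Real.norm_of_nonneg (by positivity), mul_pow, mul_pow]
    field_simp
  have hge : |v| * |A| ≤ ‖w‖ ^ 2 := by
    have h1 := Complex.abs_re_le_norm w
    have h2 := Complex.abs_im_le_norm w
    rw [hre, abs_mul, abs_of_nonneg (by positivity)] at h1
    rw [him, abs_neg, abs_mul, abs_of_nonneg (by positivity)] at h2
    have h3 : |v| ≤ ‖w‖ := by nlinarith [abs_nonneg v]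
    have h4 : |A| ≤ ‖w‖ := by
      have : 1 ≤ (2 * Real.pi) ^ 2 := by nlinarith
      nlinarith [abs_nonneg A]
    rw [sq]
    gcongr
  -- Only an inequality: at a zero of the symbol the complex inverse is `0`, while the inverse in
  -- `ℝ≥0∞` is `⊤`.
  have hinv : ‖invSymbol z k‖ₑ ≤ ‖w‖ₑ⁻¹ := by
    rcases eq_or_ne w 0 with h | h
    · simp [h]
    · rw [invSymbol, ← hw, enorm_inv h]
  calc ‖invSymbol z k‖ₑ ^ (2 * σ) ≤ (‖w‖ₑ⁻¹) ^ (2 * σ) := by gcongr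
    _ = (‖w‖ₑ ^ 2) ^ (-σ) := by
        rw [ENNReal.inv_rpow, ← ENNReal.rpow_neg, ← ENNReal.rpow_natCast, ← ENNReal.rpow_mul]
        norm_num
    _ ≤ (‖v‖ₑ * ‖A‖ₑ) ^ (-σ) := by
        refine rpow_neg_antitone hσ ?_
        rw [← ofReal_norm, ← ofReal_norm, ← ofReal_norm, ← ENNReal.ofReal_mul (norm_nonneg _),
          ← ENNReal.ofReal_pow (norm_nonneg _)]
        exact ENNReal.ofReal_le_ofReal hge
    _ = _ := ENNReal.mul_rpow_of_ne_top enorm_ne_top enorm_ne_top _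

theorem enorm_time_rpow_le {n : ℕ} {σ : ℝ} (hσ : 0 < σ) (x : SpaceTime n) :
    ‖2 * Real.pi * inner ℝ (timeDir n) x‖ₑ ^ σ ≤
      ENNReal.ofReal ((2 * Real.pi) ^ 2) ^ σ * ENNReal.ofReal (weight x ^ σ) := by
  rw [← ENNReal.ofReal_rpow_of_pos (weight_pos x), ← ENNReal.mul_rpow_of_nonneg _ _ hσ.le,
    ← ENNReal.ofReal_mul (by positivity), ← ofReal_norm, inner_timeDir]
  refine ENNReal.rpow_le_rpow (ENNReal.ofReal_le_ofReal ?_) hσ.le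
  rw [Real.norm_eq_abs, abs_mul, abs_of_pos Real.two_pi_pos]
  have hw : |x.snd| ≤ weight x := by
    unfold weight
    have := sq_abs x.snd
    nlinarith [sq_nonneg ‖x.fst‖, sq_nonneg (|x.snd| - 1)]
  have hpi := Real.pi_gt_three
  gcongr
  nlinarith

/-- Two singularities of exponent `σ` fit a single weight of exponent `σ` because `|t| |x_j| ≤ 1 +
|x|² + t²`. -/
theorem enorm_time_mul_space_rpow_le {n : ℕ} {σ : ℝ} (hσ : 0 < σ) (j : Fin n) (x : SpaceTime n) :
    ‖2 * Real.pi * inner ℝ (timeDir n) x‖ₑ ^ σ * ‖2 * Real.pi * inner ℝ (spaceDir j) x‖ₑ ^ σ ≤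
      ENNReal.ofReal ((2 * Real.pi) ^ 2) ^ σ * ENNReal.ofReal (weight x ^ σ) := by
  rw [← ENNReal.ofReal_rpow_of_pos (weight_pos x), ← ENNReal.mul_rpow_of_nonneg _ _ hσ.le,
    ← ENNReal.mul_rpow_of_nonneg _ _ hσ.le, ← ENNReal.ofReal_mul (by positivity), ← ofReal_norm,
    ← ofReal_norm, ← ENNReal.ofReal_mul (norm_nonneg _), inner_timeDir, inner_spaceDir]
  refine ENNReal.rpow_le_rpow (ENNReal.ofReal_le_ofReal ?_) hσ.le
  rw [Real.norm_eq_abs, Real.norm_eq_abs, abs_mul (2 * Real.pi), abs_mul (2 * Real.pi),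
    abs_of_pos Real.two_pi_pos]
  have hj : |x.fst j| ≤ ‖x.fst‖ := PiLp.norm_apply_le x.fst j
  have hw : |x.snd| * |x.fst j| ≤ weight x := by
    unfold weight
    have := sq_abs x.snd
    nlinarith [sq_nonneg (|x.snd| - ‖x.fst‖), abs_nonneg x.snd, sq_nonneg ‖x.fst‖,
      mul_le_mul_of_nonneg_left hj (abs_nonneg x.snd)]
  calc 2 * Real.pi * |x.snd| * (2 * Real.pi * |x.fst j|)
      = (2 * Real.pi) ^ 2 * (|x.snd| * |x.fst j|) := by ring
    _ ≤ _ := by gcongr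

/-- The hyperplane is handled by Hardy in time with shift `c`, each sheet of the sphere by Hardy in
`k_j` with shift `cp j` or `cm j`. These last depend only on the other space coordinates, as the
double Hardy inequality demands. The constant sees `z` only through `R`. -/
theorem lintegral_invSymbol_rpow_le (n : ℕ) {R σ : ℝ} (hR : 0 < R) (h0 : 0 < σ) (h1 : σ < 1) :
    ∃ C : ℝ≥0∞, C ≠ ⊤ ∧ ∀ z : Fin n → ℂ, R ≤ ‖imVec z‖ → ∀ f : 𝓢(SpaceTime n, ℂ),
      ∫⁻ k, ‖f k‖ₑ ^ 2 * ‖invSymbol z k‖ₑ ^ (2 * σ) ≤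
        C * ∫⁻ x, ‖𝓕 f x‖ₑ ^ 2 * ENNReal.ofReal (weight x ^ σ) := by
  obtain ⟨K, hK, hsphere⟩ := exists_enorm_sq_sub_sq_rpow_le n
    (R := (2 * Real.pi)⁻¹ * R) (by positivity) h0
  obtain ⟨C₁, hC₁, hardy₁⟩ := fractional_hardy (SpaceTime n) h0 h1
  obtain ⟨C₂, hC₂, hardy₂⟩ := fractional_hardy_two (SpaceTime n) h0 h1
  set L : ℝ≥0∞ := ENNReal.ofReal ((2 * Real.pi) ^ 2) ^ σ with hL
  have hLtop : L ≠ ⊤ := ENNReal.rpow_ne_top_of_nonneg h0.le ENNReal.ofReal_ne_top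
  refine ⟨K * (C₁ * L + ∑ _j : Fin n, (C₂ * L + C₂ * L)), ENNReal.mul_ne_top hK
    (ENNReal.add_ne_top.2
    ⟨ENNReal.mul_ne_top hC₁ hLtop, ENNReal.sum_ne_top.2 fun j _ => ENNReal.add_ne_top.2
      ⟨ENNReal.mul_ne_top hC₂ hLtop, ENNReal.mul_ne_top hC₂ hLtop⟩⟩), fun z hz f => ?_⟩
  set b := (2 * Real.pi)⁻¹ • imVec z with hb
  set β := (2 * Real.pi)⁻¹ * ‖imVec z‖ with hβ
  set c : SpaceTime n → ℝ := fun k => -(2 * ∑ j, (z j).re * k.fst j) with hc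
  set cp : Fin n → SpaceTime n → ℝ := fun j k => sphereRoot β j (k.fst + b) - b j with hcp
  set cm : Fin n → SpaceTime n → ℝ := fun j k => -sphereRoot β j (k.fst + b) - b j with hcm
  set T := ∫⁻ x, ‖𝓕 f x‖ₑ ^ 2 * ENNReal.ofReal (weight x ^ σ) with hT
  have hcmeas : Measurable c := by fun_prop
  have hroot : ∀ j, Measurable fun k : SpaceTime n => sphereRoot β j (k.fst + b) := fun j =>
    ((continuous_sphereRoot β j).comp (by fun_prop)).measurable
  have hcpm : ∀ j, Measurable (cp j) := fun j => (hroot j).sub_const _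
  have hcmm : ∀ j, Measurable (cm j) := fun j => (hroot j).neg.sub_const _
  have hfstT : ∀ (k : SpaceTime n) (s : ℝ), (k + s • timeDir n).fst = k.fst := fun k s => by
    simp [timeDir]
  have hfstX : ∀ j (k : SpaceTime n) (s : ℝ), (k + s • spaceDir j).fst + b =
      k.fst + b + s • EuclideanSpace.single j 1 := fun j k s => by
    simp [spaceDir]
    abel
  have hfm := f.continuous.measurable
  have hsingle : ∫⁻ k, ‖f k‖ₑ ^ 2 * ‖k.snd - c k‖ₑ ^ (-σ) ≤ C₁ * L * T := by
    have h := hardy₁ (innerSL ℝ (timeDir n)) (timeDir n) c f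
      (by simp [timeDir]) hcmeas (fun p s => by simp only [hc, hfstT])
    simp only [innerSL_apply_apply, inner_timeDir] at h
    refine h.trans ?_
    rw [mul_assoc, hT, ← lintegral_const_mul' _ _ hLtop]
    gcongr C₁ * ?_
    refine lintegral_mono fun x => ?_
    rw [mul_comm, mul_left_comm]
    gcongr
    simpa only [inner_timeDir] using enorm_time_rpow_le h0 x
  have hdouble : ∀ (j : Fin n) (c' : SpaceTime n → ℝ), Measurable c' →
      (∀ p (s : ℝ), c' (p + s • timeDir n) = c' p) →
      (∀ p (s : ℝ), c' (p + s • spaceDir j) = c' p) →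
      ∫⁻ k, ‖f k‖ₑ ^ 2 * ‖k.snd - c k‖ₑ ^ (-σ) * ‖k.fst j - c' k‖ₑ ^ (-σ) ≤ C₂ * L * T := by
    intro j c' hc' hct hcx
    have h := hardy₂ (innerSL ℝ (timeDir n)) (innerSL ℝ (spaceDir j)) (timeDir n) (spaceDir j)
      c c' f (by simp [timeDir]) (by simp [spaceDir])
      (by simp [spaceDir, timeDir]) hcmeas hc' (fun p s => by simp only [hc, hfstT]) hct hcx
    simp only [innerSL_apply_apply, inner_timeDir, inner_spaceDir] at h
    refine h.trans ?_
    rw [mul_assoc, hT, ← lintegral_const_mul' _ _ hLtop]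
    gcongr C₂ * ?_
    refine lintegral_mono fun x => ?_
    have hx := enorm_time_mul_space_rpow_le h0 j x
    rw [inner_timeDir, inner_spaceDir] at hx
    calc _ = ‖𝓕 f x‖ₑ ^ 2 * (‖2 * Real.pi * x.snd‖ₑ ^ σ * ‖2 * Real.pi * x.fst j‖ₑ ^ σ) := by ring
      _ ≤ ‖𝓕 f x‖ₑ ^ 2 * (L * ENNReal.ofReal (weight x ^ σ)) := by gcongr
      _ = _ := by ring
  calc ∫⁻ k, ‖f k‖ₑ ^ 2 * ‖invSymbol z k‖ₑ ^ (2 * σ)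
      ≤ ∫⁻ k, K * (‖f k‖ₑ ^ 2 * ‖k.snd - c k‖ₑ ^ (-σ) + ∑ j,
          (‖f k‖ₑ ^ 2 * ‖k.snd - c k‖ₑ ^ (-σ) * ‖k.fst j - cp j k‖ₑ ^ (-σ) +
            ‖f k‖ₑ ^ 2 * ‖k.snd - c k‖ₑ ^ (-σ) * ‖k.fst j - cm j k‖ₑ ^ (-σ))) := by
        refine lintegral_mono fun k => ?_
        have hs := hsphere β (k.fst + b) (by rw [hβ]; gcongr)
        have e1 : ∀ j, (k.fst + b) j - sphereRoot β j (k.fst + b) = k.fst j - cp j k := fun j => by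
          simp only [hcp, PiLp.add_apply]; ring
        have e2 : ∀ j, (k.fst + b) j + sphereRoot β j (k.fst + b) = k.fst j - cm j k := fun j => by
          simp only [hcm, PiLp.add_apply]; ring
        simp only [e1, e2] at hs
        calc ‖f k‖ₑ ^ 2 * ‖invSymbol z k‖ₑ ^ (2 * σ)
            ≤ ‖f k‖ₑ ^ 2 * (‖k.snd - c k‖ₑ ^ (-σ) * (K * (1 + ∑ j,
              (‖k.fst j - cp j k‖ₑ ^ (-σ) + ‖k.fst j - cm j k‖ₑ ^ (-σ))))) := by
              gcongr
              refine (enorm_invSymbol_rpow_le z h0 k).trans ?_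
              gcongr
          _ = _ := by
              rw [← mul_assoc, mul_left_comm, mul_add, mul_one, Finset.mul_sum]
              simp_rw [mul_add]
    _ = K * (∫⁻ k, ‖f k‖ₑ ^ 2 * ‖k.snd - c k‖ₑ ^ (-σ) + ∑ j,
          (‖f k‖ₑ ^ 2 * ‖k.snd - c k‖ₑ ^ (-σ) * ‖k.fst j - cp j k‖ₑ ^ (-σ) +
            ‖f k‖ₑ ^ 2 * ‖k.snd - c k‖ₑ ^ (-σ) * ‖k.fst j - cm j k‖ₑ ^ (-σ))) :=
        lintegral_const_mul' _ _ hK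
    _ = K * ((∫⁻ k, ‖f k‖ₑ ^ 2 * ‖k.snd - c k‖ₑ ^ (-σ)) + ∑ j,
          ((∫⁻ k, ‖f k‖ₑ ^ 2 * ‖k.snd - c k‖ₑ ^ (-σ) * ‖k.fst j - cp j k‖ₑ ^ (-σ)) +
            ∫⁻ k, ‖f k‖ₑ ^ 2 * ‖k.snd - c k‖ₑ ^ (-σ) * ‖k.fst j - cm j k‖ₑ ^ (-σ))) := by
        rw [lintegral_add_left (by fun_prop), lintegral_finsetSum _ (fun j _ => by fun_prop)]
        congr 2
        refine Finset.sum_congr rfl fun j _ => ?_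
        rw [lintegral_add_left (by fun_prop)]
    _ ≤ K * (C₁ * L * T + ∑ _j : Fin n, (C₂ * L * T + C₂ * L * T)) := by
        gcongr with j
        · refine hdouble j _ (hcpm j) (fun p s => ?_) (fun p s => ?_)
          · simp only [hcp, hfstT]
          · simp only [hcp, hfstX, sphereRoot_add_single]
        · refine hdouble j _ (hcmm j) (fun p s => ?_) (fun p s => ?_)
          · simp only [hcm, hfstT]
          · simp only [hcm, hfstX, sphereRoot_add_single]
    _ = _ := by
        simp_rw [← add_mul]
        rw [← Finset.sum_mul, ← add_mul, mul_assoc]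

/-! ### Convolution with `G_z` as a Fourier multiplier, and its derivatives -/

theorem integrable_invSymbol_mul {n : ℕ} {z : Fin n → ℂ} (hz : imVec z ≠ 0)
    (φ : 𝓢(SpaceTime n, ℂ)) : Integrable fun k => invSymbol z k * φ k := by
  have h := integrable_inv_symbol_mul z hz
    (SchwartzMap.compCLMOfContinuousLinearEquiv ℂ
      (ContinuousLinearEquiv.smulLeft (R₁ := ℝ) (M₁ := SpaceTime n)
        (Units.mk0 ((2 * Real.pi)⁻¹ : ℝ) (by positivity))) φ)
  have h2 := h.comp_smul (R := 2 * Real.pi) (by positivity)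
  refine h2.congr (Filter.Eventually.of_forall fun k => ?_)
  change (symbol z ((2 * Real.pi) • k))⁻¹ * φ ((2 * Real.pi)⁻¹ • (2 * Real.pi) • k) = _
  rw [inv_smul_smul₀ (by positivity)]
  rfl

/-- The solution with frequency data `φ`: the inverse Fourier transform of `φ / P_z`. -/
noncomputable def solution {n : ℕ} (z : Fin n → ℂ) (φ : 𝓢(SpaceTime n, ℂ)) : SpaceTime n → ℂ :=
  𝓕⁻ fun k => invSymbol z k * φ k

theorem finrank_spaceTime (n : ℕ) : Module.finrank ℝ (SpaceTime n) = n + 1 := by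
  have := (WithLp.linearEquiv 2 ℝ (EuclideanSpace ℝ (Fin n) × ℝ)).finrank_eq
  rw [this]
  simp

theorem fourierInv_reflectTranslate {n : ℕ} (g : 𝓢(SpaceTime n, ℂ)) (p k : SpaceTime n) :
    𝓕⁻ (reflectTranslate g p) k = Real.fourierChar (inner ℝ k p) • 𝓕 g k := by
  rw [SchwartzMap.fourierInv_coe, SchwartzMap.fourier_coe, Real.fourierInv_eq, Real.fourier_eq,
    ← integral_sub_left_eq_self (fun v => Real.fourierChar (inner ℝ v k) • reflectTranslate g p v)
      volume p, Circle.smul_def, ← integral_smul]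
  congr 1 with v
  rw [reflectTranslate_apply, sub_sub_cancel, ← Circle.smul_def, ← mul_smul,
    ← AddChar.map_add_eq_mul]
  congr 2
  rw [inner_sub_left, real_inner_comm p k, sub_eq_add_neg]

/-- Rescaling frequencies by `2π` produces the Jacobian `(2π)^{n+1}`, which cancels the
normalization of `invFourier`. -/
theorem conv_fundamentalSolution {n : ℕ} {z : Fin n → ℂ} (hz : imVec z ≠ 0)
    (g : 𝓢(SpaceTime n, ℂ)) : conv (fundamentalSolution z hz) g = solution z (𝓕 g) := by
  ext p
  have h0 : ∀ q, invFourier n (reflectTranslate g p) q = (((2 * Real.pi) ^ (n + 1) : ℝ) : ℂ)⁻¹ *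
      (𝓕⁻ (reflectTranslate g p)) (((2 * Real.pi)⁻¹ : ℝ) • q) := fun _ => rfl
  rw [conv, fundamentalSolution_apply, solution, Real.fourierInv_eq]
  have h1 := Measure.integral_comp_smul (volume : Measure (SpaceTime n))
    (fun q => (symbol z q)⁻¹ * invFourier n (reflectTranslate g p) q) (2 * Real.pi)
  have hpi : (0 : ℝ) < (2 * Real.pi) ^ (n + 1) := by positivity
  rw [finrank_spaceTime, abs_of_pos (by positivity), eq_comm, inv_smul_eq_iff₀ hpi.ne'] at h1
  rw [h1, ← integral_smul]
  congr 1 with k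
  rw [h0, inv_smul_smul₀ (by positivity), fourierInv_reflectTranslate, ← invSymbol,
    Complex.real_smul, Circle.smul_def, Circle.smul_def, smul_eq_mul, smul_eq_mul]
  have hc : (((2 * Real.pi) ^ (n + 1) : ℝ) : ℂ) ≠ 0 := by exact_mod_cast hpi.ne'
  field_simp

theorem integrable_norm_pow_mul_invSymbol_mul {n : ℕ} {z : Fin n → ℂ} (hz : imVec z ≠ 0)
    (φ : 𝓢(SpaceTime n, ℂ)) (m : ℕ) :
    Integrable fun k => ‖k‖ ^ m * ‖invSymbol z k * φ k‖ := by
  -- The power `‖k‖ ^ m` need not be smooth at `0`; this smooth majorant keeps the product Schwartz.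
  have hg : Function.HasTemperateGrowth fun k : SpaceTime n =>
      (((1 + ‖k‖ ^ 2) ^ m : ℝ) : ℂ) := by
    have := Function.hasTemperateGrowth_norm_sq (H := SpaceTime n)
    exact Function.Complex.hasTemperateGrowth_ofReal.comp (by fun_prop)
  have h := (integrable_invSymbol_mul hz (SchwartzMap.smulLeftCLM ℂ
    (fun k : SpaceTime n => (((1 + ‖k‖ ^ 2) ^ m : ℝ) : ℂ)) φ)).norm
  have hm := measurable_invSymbol z
  have hφ := φ.continuous.measurable
  refine h.mono' (Measurable.aestronglyMeasurable (by fun_prop))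
    (Filter.Eventually.of_forall fun k => ?_)
  rw [SchwartzMap.smulLeftCLM_apply_apply hg, smul_eq_mul, norm_mul, norm_mul, norm_mul, norm_mul,
    norm_mul, norm_norm, norm_norm, norm_pow, norm_norm, Complex.norm_real,
    Real.norm_of_nonneg (by positivity : (0 : ℝ) ≤ (1 + ‖k‖ ^ 2) ^ m)]
  have hk : ‖k‖ ^ m ≤ (1 + ‖k‖ ^ 2) ^ m := by
    gcongr
    nlinarith [sq_nonneg (‖k‖ - 1)]
  calc ‖k‖ ^ m * (‖invSymbol z k‖ * ‖φ k‖)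
      ≤ (1 + ‖k‖ ^ 2) ^ m * (‖invSymbol z k‖ * ‖φ k‖) := by gcongr
    _ = _ := by ring

theorem contDiff_solution {n : ℕ} {z : Fin n → ℂ} (hz : imVec z ≠ 0) (φ : 𝓢(SpaceTime n, ℂ)) :
    ContDiff ℝ ∞ (solution z φ) := by
  have h : ContDiff ℝ ∞ (𝓕 fun k => invSymbol z k * φ k) :=
    Real.contDiff_fourier fun m _ => integrable_norm_pow_mul_invSymbol_mul hz φ m
  have e : solution z φ = (𝓕 fun k => invSymbol z k * φ k) ∘ fun p => -p := by
    ext p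
    rw [solution, Real.fourierInv_eq_fourier_neg]
    rfl
  rw [e]
  exact h.comp contDiff_neg

/-- Multiplication by the symbol `2πi⟨e, ·⟩` of the derivative in the direction `e`. -/
noncomputable def mulDir {n : ℕ} (e : SpaceTime n) :
    𝓢(SpaceTime n, ℂ) →L[ℂ] 𝓢(SpaceTime n, ℂ) :=
  SchwartzMap.smulLeftCLM ℂ fun k => 2 * Real.pi * Complex.I * ((inner ℝ e k : ℝ) : ℂ)

theorem mulDir_apply {n : ℕ} (e : SpaceTime n) (φ : 𝓢(SpaceTime n, ℂ)) (k : SpaceTime n) :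
    mulDir e φ k = 2 * Real.pi * Complex.I * ((inner ℝ e k : ℝ) : ℂ) * φ k := by
  have hg : Function.HasTemperateGrowth fun k : SpaceTime n =>
      2 * Real.pi * Complex.I * ((inner ℝ e k : ℝ) : ℂ) := by
    have h := Function.Complex.hasTemperateGrowth_ofReal.comp
      (Function.hasTemperateGrowth_inner_right e)
    fun_prop
  rw [mulDir, SchwartzMap.smulLeftCLM_apply_apply hg, smul_eq_mul]

theorem norm_mulDir_apply {n : ℕ} (e : SpaceTime n) (φ : 𝓢(SpaceTime n, ℂ)) (k : SpaceTime n) :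
    ‖mulDir e φ k‖ = 2 * Real.pi * |inner ℝ e k| * ‖φ k‖ := by
  rw [mulDir_apply, norm_mul, norm_mul, Complex.norm_real, Real.norm_eq_abs]
  simp [abs_of_pos Real.pi_pos]

theorem lineDeriv_solution {n : ℕ} {z : Fin n → ℂ} (hz : imVec z ≠ 0) (φ : 𝓢(SpaceTime n, ℂ))
    (e p : SpaceTime n) :
    lineDeriv ℝ (solution z φ) p e = solution z (mulDir e φ) p := by
  set F : SpaceTime n → ℂ := fun k => invSymbol z k * φ k with hF
  have hint : Integrable F := integrable_invSymbol_mul hz φ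
  have hint1 : Integrable fun k => ‖k‖ * ‖F k‖ := by
    simpa only [pow_one] using integrable_norm_pow_mul_invSymbol_mul hz φ 1
  have hd := (Real.hasFDerivAt_fourier hint hint1 (-p)).comp p (hasFDerivAt_id p).neg
  have e1 : solution z φ = 𝓕 F ∘ Neg.neg := by
    ext p
    rw [solution, Real.fourierInv_eq_fourier_neg]
    rfl
  have hint2 : Integrable (VectorFourier.fourierSMulRight (innerSL ℝ) F) := by
    have hm : AEStronglyMeasurable F volume := hint.aestronglyMeasurable
    refine (hint1.const_mul (2 * Real.pi * ‖innerSL (E := SpaceTime n) ℝ‖)).mono'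
      hm.fourierSMulRight (Filter.Eventually.of_forall fun k => ?_)
    refine (VectorFourier.norm_fourierSMulRight_le _ _ _).trans_eq ?_
    ring
  rw [e1, HasLineDerivAt.lineDeriv (hd.hasLineDerivAt e), solution,
    Real.fourierInv_eq_fourier_neg]
  simp only [ContinuousLinearMap.comp_apply, neg_apply,
    ContinuousLinearMap.id_apply, map_neg]
  rw [Real.fourier_continuousLinearMap_apply hint2, ← neg_one_smul ℂ, Real.fourier_eq,
    Real.fourier_eq, ← integral_smul]
  congr 1 with k
  rw [VectorFourier.fourierSMulRight_apply, mulDir_apply, innerSL_apply_apply, real_inner_comm e k,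
    Circle.smul_def, Circle.smul_def, Complex.real_smul]
  simp only [smul_eq_mul, hF]
  ring

theorem partialX_solution {n : ℕ} {z : Fin n → ℂ} (hz : imVec z ≠ 0) (φ : 𝓢(SpaceTime n, ℂ))
    (j : Fin n) : partialX j (solution z φ) = solution z (mulDir (spaceDir j) φ) :=
  funext fun p => lineDeriv_solution hz φ (spaceDir j) p

theorem partialT_solution {n : ℕ} {z : Fin n → ℂ} (hz : imVec z ≠ 0) (φ : 𝓢(SpaceTime n, ℂ)) :
    partialT (solution z φ) = solution z (mulDir (timeDir n) φ) :=
  funext fun p => lineDeriv_solution hz φ (timeDir n) p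

theorem exists_iterate_partialX_solution {n : ℕ} {z : Fin n → ℂ} (hz : imVec z ≠ 0)
    (φ : 𝓢(SpaceTime n, ℂ)) (j : Fin n) (m : ℕ) :
    ∃ φ' : 𝓢(SpaceTime n, ℂ), (partialX j)^[m] (solution z φ) = solution z φ' ∧
      ∀ k, ‖φ' k‖ ≤ (2 * Real.pi * ‖k.fst‖) ^ m * ‖φ k‖ := by
  induction m with
  | zero => exact ⟨φ, rfl, fun k => by simp⟩
  | succ m ih =>
    obtain ⟨φ', h, hle⟩ := ih
    refine ⟨mulDir (spaceDir j) φ', ?_, fun k => ?_⟩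
    · rw [Function.iterate_succ_apply', h, partialX_solution hz]
    · rw [norm_mulDir_apply, inner_spaceDir, pow_succ', mul_assoc (2 * Real.pi * ‖k.fst‖)]
      have hj : |k.fst j| ≤ ‖k.fst‖ := PiLp.norm_apply_le k.fst j
      have hpi := Real.pi_pos
      gcongr
      exact hle k

/-- Each derivative only changes the data `φ`, so all estimates reduce to pointwise bounds on the
new data. -/
theorem exists_derivX_solution {n : ℕ} {z : Fin n → ℂ} (hz : imVec z ≠ 0)
    (φ : 𝓢(SpaceTime n, ℂ)) (α : Fin n → ℕ) :
    ∃ φ' : 𝓢(SpaceTime n, ℂ), derivX α (solution z φ) = solution z φ' ∧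
      ∀ k, ‖φ' k‖ ≤ (2 * Real.pi * ‖k.fst‖) ^ (∑ j, α j) * ‖φ k‖ := by
  have key : ∀ l : List (Fin n), ∃ φ' : 𝓢(SpaceTime n, ℂ),
      l.foldr (fun j h => (partialX j)^[α j] h) (solution z φ) = solution z φ' ∧
      ∀ k, ‖φ' k‖ ≤ (2 * Real.pi * ‖k.fst‖) ^ (l.map α).sum * ‖φ k‖ := by
    intro l
    induction l with
    | nil => exact ⟨φ, rfl, fun k => by simp⟩
    | cons j l ih =>
      obtain ⟨φ', h, hle⟩ := ih
      obtain ⟨φ'', h', hle'⟩ := exists_iterate_partialX_solution hz φ' j (α j)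
      refine ⟨φ'', ?_, fun k => ?_⟩
      · rw [List.foldr_cons, h, h']
      · rw [List.map_cons, List.sum_cons, pow_add, mul_assoc]
        have hpi := Real.pi_pos
        refine (hle' k).trans ?_
        gcongr
        exact hle k
  obtain ⟨φ', h, hle⟩ := key (List.finRange n)
  refine ⟨φ', h, ?_⟩
  rwa [← Fin.sum_univ_def] at hle

/-! ### Weighted norms by duality -/

section Duality

variable {V : Type*} [NormedAddCommGroup V] [InnerProductSpace ℝ V] [FiniteDimensional ℝ V]
  [MeasurableSpace V] [BorelSpace V]

theorem integral_fourierInv_mul {F ψ : V → ℂ} (hF : Integrable F) (hψ : Integrable ψ) :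
    ∫ x, 𝓕⁻ F x * ψ x = ∫ k, F k * 𝓕⁻ ψ k := by
  have h := VectorFourier.integral_fourierIntegral_smul_eq_flip (L := innerₗ V)
    Real.continuous_fourierChar continuous_inner hF.comp_neg hψ
  rw [flip_innerₗ] at h
  simp only [smul_eq_mul] at h
  rw [Real.fourierInv_eq_fourier_comp_neg]
  refine h.trans ?_
  rw [← integral_neg_eq_self]
  simp only [neg_neg]
  congr 1 with k
  rw [Real.fourierInv_eq_fourier_neg]
  rfl

theorem fourier_fourier_apply (f : 𝓢(V, ℂ)) (x : V) : 𝓕 (𝓕 f) x = f (-x) := by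
  have h := SchwartzMap.fourierInv_apply_eq (𝓕 f)
  rw [FourierTransform.fourierInv_fourier_eq] at h
  have := congrArg (fun g : 𝓢(V, ℂ) => g (-x)) h
  simpa using this.symm

end Duality

theorem rpow_half_le_of_le_mul {X A : ℝ≥0∞} (hX : X ≠ ⊤) (h : X ≤ A * X ^ (1 / 2 : ℝ)) :
    X ^ (1 / 2 : ℝ) ≤ A := by
  rcases eq_or_ne X 0 with rfl | h0
  · simp
  have hne : X ^ (1 / 2 : ℝ) ≠ 0 := by simp [ENNReal.rpow_eq_zero_iff, h0, hX]
  have htop : X ^ (1 / 2 : ℝ) ≠ ⊤ := ENNReal.rpow_ne_top_of_nonneg (by norm_num) hX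
  have hXX : X = X ^ (1 / 2 : ℝ) * X ^ (1 / 2 : ℝ) := by
    rw [← ENNReal.rpow_add _ _ h0 hX]
    norm_num
  exact (ENNReal.mul_le_mul_iff_left hne htop).1 (hXX.symm.le.trans h)

theorem weight_eq {n : ℕ} (p : SpaceTime n) : weight p = 1 + ‖p‖ ^ 2 := by
  rw [weight, WithLp.prod_norm_sq_eq_of_L2, Real.norm_eq_abs, sq_abs, add_assoc]

theorem weight_neg {n : ℕ} (p : SpaceTime n) : weight (-p) = weight p := by
  rw [weight_eq, weight_eq, norm_neg]

theorem contDiff_weight_rpow (n : ℕ) (s : ℝ) :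
    ContDiff ℝ ∞ fun p : SpaceTime n => weight p ^ s := by
  refine ContDiff.rpow_const_of_ne ?_ fun p => (weight_pos p).ne'
  rw [show (weight : SpaceTime n → ℝ) = fun p => 1 + ‖p‖ ^ 2 from funext weight_eq]
  exact contDiff_const.add (contDiff_norm_sq ℝ)

theorem weightedNorm_def {n : ℕ} (s : ℝ) (f : SpaceTime n → ℂ) :
    weightedNorm s f = (∫⁻ p, ‖f p‖ₑ ^ 2 * ENNReal.ofReal (weight p ^ s)) ^ (1 / 2 : ℝ) := rfl

theorem lintegral_mul_le_rpow_half_mul {n : ℕ} {f g : SpaceTime n → ℝ≥0∞}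
    (hf : Measurable f) (hg : Measurable g) :
    ∫⁻ k, f k * g k ≤ (∫⁻ k, f k ^ 2) ^ (1 / 2 : ℝ) * (∫⁻ k, g k ^ 2) ^ (1 / 2 : ℝ) := by
  simpa using ENNReal.lintegral_mul_le_Lp_mul_Lq volume Real.HolderConjugate.two_two
    hf.aemeasurable hg.aemeasurable

theorem lintegral_invSymbol_mul_le {n : ℕ} (z : Fin n → ℂ) (s : ℝ) (f g : 𝓢(SpaceTime n, ℂ)) :
    ∫⁻ k, ‖invSymbol z k‖ₑ * (‖f k‖ₑ * ‖g k‖ₑ) ≤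
      (∫⁻ k, ‖f k‖ₑ ^ 2 * ‖invSymbol z k‖ₑ ^ (2 * s)) ^ (1 / 2 : ℝ) *
        (∫⁻ k, ‖g k‖ₑ ^ 2 * ‖invSymbol z k‖ₑ ^ (2 * (1 - s))) ^ (1 / 2 : ℝ) := by
  have hm := measurable_invSymbol z
  have hf := f.continuous.measurable
  have hg := g.continuous.measurable
  have h := lintegral_mul_le_rpow_half_mul (f := fun k => ‖f k‖ₑ * ‖invSymbol z k‖ₑ ^ s)
    (g := fun k => ‖g k‖ₑ * ‖invSymbol z k‖ₑ ^ (1 - s)) (by fun_prop) (by fun_prop)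
  have e : ∀ (t : ℝ) (k : SpaceTime n), (‖invSymbol z k‖ₑ ^ t) ^ 2 =
      ‖invSymbol z k‖ₑ ^ (2 * t) := by
    intro t k
    rw [← ENNReal.rpow_natCast, ← ENNReal.rpow_mul, mul_comm]
    rfl
  simp only [mul_pow, e] at h
  refine le_trans (lintegral_mono fun k => ?_) h
  rcases eq_or_ne (invSymbol z k) 0 with h0 | h0
  · simp [h0]
  have e2 : ‖invSymbol z k‖ₑ = ‖invSymbol z k‖ₑ ^ s * ‖invSymbol z k‖ₑ ^ (1 - s) := by
    rw [← ENNReal.rpow_add _ _ (by simpa using h0) enorm_ne_top]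
    simp
  nth_rw 1 [e2]
  apply le_of_eq
  ring

/-- Testing against `ψ = weight ^ δ * χ * conj u` makes the pairing equal to the cut-off norm
squared `X`, while `χ ≤ 1` bounds the dual norm of `ψ` by `X ^ (1/2)`. The cutoff makes `ψ` Schwartz
and `X` finite, so `X ≤ A * X ^ (1/2)` can be divided. -/
theorem lintegral_cutoff_solution_le {n : ℕ} {z : Fin n → ℂ} (hz : imVec z ≠ 0) {δ : ℝ}
    (φ : 𝓢(SpaceTime n, ℂ)) {A : ℝ≥0∞}
    (hA : ∀ ψ : 𝓢(SpaceTime n, ℂ), ∫⁻ k, ‖invSymbol z k * φ k‖ₑ * ‖𝓕⁻ ψ k‖ₑ ≤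
      A * (∫⁻ x, ‖ψ x‖ₑ ^ 2 * ENNReal.ofReal (weight x ^ (-δ))) ^ (1 / 2 : ℝ))
    {χ : SpaceTime n → ℝ} (hχ : ContDiff ℝ ∞ χ) (hχc : HasCompactSupport χ) (hχ0 : ∀ x, 0 ≤ χ x)
    (hχ1 : ∀ x, χ x ≤ 1) :
    (∫⁻ x, ‖solution z φ x‖ₑ ^ 2 * ENNReal.ofReal (weight x ^ δ * χ x)) ^ (1 / 2 : ℝ) ≤ A := by
  set u := solution z φ with hu
  have hus : ContDiff ℝ ∞ u := contDiff_solution hz φ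
  set v : SpaceTime n → ℝ := fun x => weight x ^ δ * χ x with hv
  have hvs : ContDiff ℝ ∞ v := (contDiff_weight_rpow n δ).mul hχ
  have hv0 : ∀ x, 0 ≤ v x := fun x =>
    mul_nonneg (Real.rpow_nonneg (weight_pos x).le _) (hχ0 x)
  have hvc : HasCompactSupport v := hχc.mul_left
  set ψ₀ : SpaceTime n → ℂ := fun x => (v x : ℂ) * Complex.conjCLE (u x) with hψ₀
  have hψs : ContDiff ℝ ∞ ψ₀ :=
    (Complex.ofRealCLM.contDiff.comp hvs).mul (Complex.conjCLE.contDiff.comp hus)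
  have hψc : HasCompactSupport ψ₀ := by
    refine HasCompactSupport.mul_right ?_
    exact hvc.comp_left (g := fun r : ℝ => (r : ℂ)) Complex.ofReal_zero
  set ψ : 𝓢(SpaceTime n, ℂ) := hψc.toSchwartzMap hψs with hψ
  have hψa : ∀ x, ψ x = (v x : ℂ) * Complex.conjCLE (u x) := fun x => rfl
  set h : SpaceTime n → ℝ := fun x => ‖u x‖ ^ 2 * v x with hh
  have hhc : HasCompactSupport h := hvc.mul_left
  have hhint : Integrable h :=
    Continuous.integrable_of_hasCompactSupport ((hus.continuous.norm.pow 2).mul hvs.continuous) hhc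
  have hX : ∫⁻ x, ‖u x‖ₑ ^ 2 * ENNReal.ofReal (v x) = ENNReal.ofReal (∫ x, h x) := by
    rw [ofReal_integral_eq_lintegral_ofReal hhint
      (Filter.Eventually.of_forall fun x => mul_nonneg (sq_nonneg _) (hv0 x))]
    refine lintegral_congr fun x => ?_
    rw [hh, ENNReal.ofReal_mul (sq_nonneg _), ENNReal.ofReal_pow (norm_nonneg _), ofReal_norm]
  have hpair : ∫ x, u x * ψ x = ((∫ x, h x : ℝ) : ℂ) := by
    rw [← integral_complex_ofReal]
    congr 1 with x
    rw [hψa, hh, Complex.conjCLE_apply, mul_left_comm, Complex.mul_conj, Complex.normSq_eq_norm_sq]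
    push_cast
    ring
  have hdual : ∫ x, u x * ψ x = ∫ k, invSymbol z k * φ k * 𝓕⁻ ψ k := by
    rw [SchwartzMap.fourierInv_coe]
    exact integral_fourierInv_mul (integrable_invSymbol_mul hz φ) ψ.integrable
  have hbound : ∫⁻ x, ‖u x‖ₑ ^ 2 * ENNReal.ofReal (v x) ≤
      A * (∫⁻ x, ‖ψ x‖ₑ ^ 2 * ENNReal.ofReal (weight x ^ (-δ))) ^ (1 / 2 : ℝ) := by
    have e : ENNReal.ofReal (∫ x, h x) = ‖∫ k, invSymbol z k * φ k * 𝓕⁻ ψ k‖ₑ := by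
      rw [← hdual, hpair, ← ofReal_norm, Complex.norm_real, Real.norm_of_nonneg]
      exact integral_nonneg fun x => mul_nonneg (sq_nonneg _) (hv0 x)
    rw [hX, e]
    refine le_trans ((enorm_integral_le_lintegral_enorm _).trans_eq ?_) (hA ψ)
    simp_rw [enorm_mul]
  have hψle : ∫⁻ x, ‖ψ x‖ₑ ^ 2 * ENNReal.ofReal (weight x ^ (-δ)) ≤
      ∫⁻ x, ‖u x‖ₑ ^ 2 * ENNReal.ofReal (v x) := by
    refine lintegral_mono fun x => ?_
    have hw := weight_pos x
    rw [← ofReal_norm, ← ofReal_norm, ← ENNReal.ofReal_pow (norm_nonneg _),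
      ← ENNReal.ofReal_pow (norm_nonneg _), ← ENNReal.ofReal_mul (sq_nonneg _),
      ← ENNReal.ofReal_mul (sq_nonneg _)]
    refine ENNReal.ofReal_le_ofReal ?_
    rw [hψa, norm_mul, Complex.norm_real, Real.norm_of_nonneg (hv0 x), Complex.conjCLE_apply,
      Complex.norm_conj, hv]
    have e : weight x ^ δ * weight x ^ (-δ) = 1 := by
      rw [← Real.rpow_add hw]
      simp
    calc (weight x ^ δ * χ x * ‖u x‖) ^ 2 * weight x ^ (-δ)
        = ‖u x‖ ^ 2 * (weight x ^ δ * χ x) * χ x * (weight x ^ δ * weight x ^ (-δ)) := by ring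
      _ ≤ ‖u x‖ ^ 2 * (weight x ^ δ * χ x) * 1 * (weight x ^ δ * weight x ^ (-δ)) := by
          have := hv0 x
          gcongr
          exact hχ1 x
      _ = _ := by rw [e]; ring
  refine rpow_half_le_of_le_mul ?_ (hbound.trans ?_)
  · rw [hX]
    exact ENNReal.ofReal_ne_top
  · gcongr

/-- The cut-off bound is uniform, so it passes to the limit along balls exhausting the space. -/
theorem weightedNorm_solution_le {n : ℕ} {z : Fin n → ℂ} (hz : imVec z ≠ 0) {δ : ℝ}
    (φ : 𝓢(SpaceTime n, ℂ)) {A : ℝ≥0∞}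
    (hA : ∀ ψ : 𝓢(SpaceTime n, ℂ), ∫⁻ k, ‖invSymbol z k * φ k‖ₑ * ‖𝓕⁻ ψ k‖ₑ ≤
      A * (∫⁻ x, ‖ψ x‖ₑ ^ 2 * ENNReal.ofReal (weight x ^ (-δ))) ^ (1 / 2 : ℝ)) :
    weightedNorm δ (solution z φ) ≤ A := by
  have hcont := (contDiff_solution hz φ).continuous
  have hwm : Measurable fun p : SpaceTime n => weight p ^ δ :=
    (contDiff_weight_rpow n δ).continuous.measurable
  have hball : ∀ N : ℕ, ∫⁻ x in Metric.closedBall (0 : SpaceTime n) N,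
      ‖solution z φ x‖ₑ ^ 2 * ENNReal.ofReal (weight x ^ δ) ≤ A ^ 2 := by
    intro N
    let χ : ContDiffBump (0 : SpaceTime n) := ⟨N + 1, N + 2, by positivity, by linarith⟩
    have h := lintegral_cutoff_solution_le hz φ hA χ.contDiff χ.hasCompactSupport
      (fun x => χ.nonneg) (fun x => χ.le_one)
    have h2 := ENNReal.pow_le_pow_left (n := 2) h
    rw [← ENNReal.rpow_natCast, ← ENNReal.rpow_mul] at h2
    norm_num at h2
    refine le_trans ?_ h2
    refine le_trans (setLIntegral_mono' Metric.isClosed_closedBall.measurableSet fun x hx => ?_)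
      (setLIntegral_le_lintegral (Metric.closedBall (0 : SpaceTime n) N) _)
    rw [χ.one_of_mem_closedBall, mul_one]
    exact Metric.closedBall_subset_closedBall (by simp [χ]) hx
  have hlim := (aecover_closedBall (μ := (volume : Measure (SpaceTime n))) (x := 0)
    tendsto_natCast_atTop_atTop).lintegral_tendsto_of_nat
    (f := fun x => ‖solution z φ x‖ₑ ^ 2 * ENNReal.ofReal (weight x ^ δ))
    (hcont.enorm.measurable.pow_const 2 |>.mul hwm.ennreal_ofReal).aemeasurable
  have hle := le_of_tendsto' hlim hball
  rw [weightedNorm_def]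
  calc _ ≤ (A ^ 2) ^ (1 / 2 : ℝ) := by gcongr
    _ = A := by
      rw [← ENNReal.rpow_natCast, ← ENNReal.rpow_mul]
      norm_num

/-- The part with `K₁` is Cauchy-Schwarz with exponents `δ + 1` and `-δ` on `1 / |P_z|`, both in
`(0, 1)`. The part with `K₀` is plain Plancherel, since both weights are at least one. -/
theorem exists_weightedNorm_solution_le (n : ℕ) {δ R : ℝ} (hδ : -1 < δ) (hδ' : δ < 0)
    (hR : 0 < R) :
    ∃ C : ℝ, 0 < C ∧ ∀ z : Fin n → ℂ, imVec z ≠ 0 → R ≤ ‖imVec z‖ →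
      ∀ (g φ : 𝓢(SpaceTime n, ℂ)) (K₁ K₀ : ℝ), 0 ≤ K₁ → 0 ≤ K₀ →
        (∀ k, ‖invSymbol z k‖ * ‖φ k‖ ≤ (K₁ * ‖invSymbol z k‖ + K₀) * ‖𝓕 g k‖) →
        weightedNorm δ (solution z φ) ≤
          ENNReal.ofReal (K₁ * C + K₀) * weightedNorm (δ + 1) g := by
  obtain ⟨C₁, hC₁, core₁⟩ := lintegral_invSymbol_rpow_le n hR (σ := δ + 1) (by linarith)
    (by linarith)
  obtain ⟨C₂, hC₂, core₂⟩ := lintegral_invSymbol_rpow_le n hR (σ := -δ) (by linarith)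
    (by linarith)
  set C₃ : ℝ≥0∞ := C₁ ^ (1 / 2 : ℝ) * C₂ ^ (1 / 2 : ℝ) with hC₃
  have hC₃t : C₃ ≠ ⊤ := ENNReal.mul_ne_top
    (ENNReal.rpow_ne_top_of_nonneg (by norm_num) hC₁)
    (ENNReal.rpow_ne_top_of_nonneg (by norm_num) hC₂)
  refine ⟨C₃.toReal + 1, by positivity, fun z hz hzR g φ K₁ K₀ hK₁ hK₀ hdom =>
    weightedNorm_solution_le hz φ fun ψ => ?_⟩
  set M := ∫⁻ x, ‖ψ x‖ₑ ^ 2 * ENNReal.ofReal (weight x ^ (-δ)) with hM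
  have hm := measurable_invSymbol z
  have hgm := (𝓕 g).continuous.measurable
  have hψm := (𝓕⁻ ψ).continuous.measurable
  have hN : (∫⁻ x, ‖𝓕 (𝓕 g) x‖ₑ ^ 2 * ENNReal.ofReal (weight x ^ (δ + 1))) ^ (1 / 2 : ℝ) =
      weightedNorm (δ + 1) g := by
    rw [weightedNorm_def, ← lintegral_neg_eq_self]
    simp_rw [fourier_fourier_apply, weight_neg, neg_neg]
  have hL2 : ∀ (f : 𝓢(SpaceTime n, ℂ)) (s : ℝ), 0 ≤ s →
      ∫⁻ x, ‖f x‖ₑ ^ 2 ≤ ∫⁻ x, ‖𝓕 f x‖ₑ ^ 2 * ENNReal.ofReal (weight x ^ s) := by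
    intro f s hs
    rw [← lintegral_enorm_sq_fourier]
    refine lintegral_mono fun x => ?_
    refine le_mul_of_one_le_right zero_le ?_
    rw [ENNReal.one_le_ofReal]
    exact Real.one_le_rpow (one_le_weight x) hs
  have hψψ : 𝓕 (𝓕⁻ ψ) = ψ := FourierTransform.fourier_fourierInv_eq ψ
  have hnear : ∫⁻ k, ‖invSymbol z k‖ₑ * (‖𝓕 g k‖ₑ * ‖𝓕⁻ ψ k‖ₑ) ≤
      C₃ * (weightedNorm (δ + 1) g * M ^ (1 / 2 : ℝ)) := by
    refine (lintegral_invSymbol_mul_le z (δ + 1) (𝓕 g) (𝓕⁻ ψ)).trans ?_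
    have a1 := core₁ z hzR (𝓕 g)
    have a2 := core₂ z hzR (𝓕⁻ ψ)
    rw [hψψ, ← hM] at a2
    rw [show 1 - (δ + 1) = -δ by ring]
    calc _ ≤ (C₁ * ∫⁻ x, ‖𝓕 (𝓕 g) x‖ₑ ^ 2 * ENNReal.ofReal (weight x ^ (δ + 1))) ^ (1 / 2 : ℝ) *
          (C₂ * M) ^ (1 / 2 : ℝ) := by gcongr
      _ = _ := by
        rw [ENNReal.mul_rpow_of_nonneg _ _ (by norm_num), hN,
          ENNReal.mul_rpow_of_nonneg _ _ (by norm_num), hC₃]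
        ring
  have hfar : ∫⁻ k, ‖𝓕 g k‖ₑ * ‖𝓕⁻ ψ k‖ₑ ≤ weightedNorm (δ + 1) g * M ^ (1 / 2 : ℝ) := by
    refine (lintegral_mul_le_rpow_half_mul (by fun_prop) (by fun_prop)).trans ?_
    rw [← hN, hM]
    have a2 := hL2 (𝓕⁻ ψ) (-δ) (by linarith)
    rw [hψψ] at a2
    have a1 := hL2 (𝓕 g) (δ + 1) (by linarith)
    exact mul_le_mul' (ENNReal.rpow_le_rpow a1 (by norm_num))
      (ENNReal.rpow_le_rpow a2 (by norm_num))
  calc ∫⁻ k, ‖invSymbol z k * φ k‖ₑ * ‖𝓕⁻ ψ k‖ₑ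
      ≤ ∫⁻ k, (ENNReal.ofReal K₁ * (‖invSymbol z k‖ₑ * (‖𝓕 g k‖ₑ * ‖𝓕⁻ ψ k‖ₑ)) +
          ENNReal.ofReal K₀ * (‖𝓕 g k‖ₑ * ‖𝓕⁻ ψ k‖ₑ)) := by
        refine lintegral_mono fun k => ?_
        have hk : ‖invSymbol z k * φ k‖ₑ ≤
            (ENNReal.ofReal K₁ * ‖invSymbol z k‖ₑ + ENNReal.ofReal K₀) * ‖𝓕 g k‖ₑ := by
          rw [← ofReal_norm, ← ofReal_norm, ← ofReal_norm, ← ENNReal.ofReal_mul hK₁,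
            ← ENNReal.ofReal_add (by positivity) hK₀, ← ENNReal.ofReal_mul (by positivity),
            norm_mul]
          exact ENNReal.ofReal_le_ofReal (hdom k)
        calc _ ≤ (ENNReal.ofReal K₁ * ‖invSymbol z k‖ₑ + ENNReal.ofReal K₀) * ‖𝓕 g k‖ₑ *
              ‖𝓕⁻ ψ k‖ₑ := by gcongr
          _ = _ := by ring
    _ = ENNReal.ofReal K₁ * (∫⁻ k, ‖invSymbol z k‖ₑ * (‖𝓕 g k‖ₑ * ‖𝓕⁻ ψ k‖ₑ)) +
          ENNReal.ofReal K₀ * ∫⁻ k, ‖𝓕 g k‖ₑ * ‖𝓕⁻ ψ k‖ₑ := by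
        rw [lintegral_add_left (by fun_prop), lintegral_const_mul' _ _ ENNReal.ofReal_ne_top,
          lintegral_const_mul' _ _ ENNReal.ofReal_ne_top]
    _ ≤ ENNReal.ofReal K₁ * (ENNReal.ofReal (C₃.toReal + 1) *
          (weightedNorm (δ + 1) g * M ^ (1 / 2 : ℝ))) +
          ENNReal.ofReal K₀ * (weightedNorm (δ + 1) g * M ^ (1 / 2 : ℝ)) := by
        gcongr
        refine hnear.trans ?_
        gcongr
        rw [← ENNReal.ofReal_toReal hC₃t]
        exact ENNReal.ofReal_le_ofReal (by simp)
    _ = _ := by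
        rw [ENNReal.ofReal_add (by positivity) hK₀, ENNReal.ofReal_mul hK₁]
        ring

/-! ### Multiplier bounds for the derivatives -/

theorem symbol_norm_lower_bounds {n : ℕ} (z : Fin n → ℂ) (k : SpaceTime n) :
    (2 * Real.pi * ‖k.fst‖) ^ 2 - 2 * (2 * Real.pi * ‖k.fst‖) * ‖imVec z‖ ≤
      ‖symbol z ((2 * Real.pi) • k)‖ ∧
    2 * Real.pi * |k.snd| ≤ ‖symbol z ((2 * Real.pi) • k)‖ +
      2 * ‖reVec z‖ * (2 * Real.pi * ‖k.fst‖) := by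
  set ξ : EuclideanSpace ℝ (Fin n) := ((2 * Real.pi) • k).fst with hξ
  have hn : ‖ξ‖ = 2 * Real.pi * ‖k.fst‖ := by
    rw [hξ, WithLp.smul_fst, norm_smul, Real.norm_of_nonneg Real.two_pi_pos.le]
  rw [← hn]
  constructor
  · refine le_trans ?_ ((le_abs_self _).trans (Complex.abs_re_le_norm _))
    rw [symbol_re, ← hξ, @norm_add_sq_real]
    have h := neg_le_of_abs_le (abs_real_inner_le_norm ξ (imVec z))
    nlinarith
  · have him := Complex.abs_im_le_norm (symbol z ((2 * Real.pi) • k))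
    rw [symbol_im, abs_neg, WithLp.smul_snd, smul_eq_mul] at him
    have hin : ∑ j, (z j).re * ((2 * Real.pi) • k).fst j = inner ℝ ξ (reVec z) := by
      simp [PiLp.inner_apply, reVec, hξ]
    rw [hin] at him
    have h1 := abs_real_inner_le_norm ξ (reVec z)
    have h2 := abs_sub (2 * Real.pi * k.snd + 2 * inner ℝ ξ (reVec z)) (2 * inner ℝ ξ (reVec z))
    rw [add_sub_cancel_right, abs_mul, abs_mul 2 (inner ℝ ξ (reVec z)), abs_two,
      abs_of_pos Real.two_pi_pos] at h2
    nlinarith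

/-- For `r ≤ 4 * β` the power is at most `4² * β ^ m`. For `r ≥ 4 * β` the real part gives `|P_z| ≥
r² - 2rβ ≥ r² / 2`, and `r ^ (m - 2) ≤ β ^ (m - 2) ≤ β ^ m / R²` because `m ≤ 2`. -/
theorem pow_mul_norm_invSymbol_le {n : ℕ} {R : ℝ} (hR : 0 < R) {z : Fin n → ℂ}
    (hz : R ≤ ‖imVec z‖) (k : SpaceTime n) {m : ℕ} (hm : m ≤ 2) :
    (2 * Real.pi * ‖k.fst‖) ^ m * ‖invSymbol z k‖ ≤
      ‖imVec z‖ ^ m * (16 * ‖invSymbol z k‖ + 2 * (R ^ 2)⁻¹) := by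
  set r := 2 * Real.pi * ‖k.fst‖ with hr
  set β := ‖imVec z‖ with hβ
  have hβ0 : 0 < β := hR.trans_le hz
  have hpi := Real.pi_pos
  have hr0 : 0 ≤ r := by positivity
  rcases le_total r (4 * β) with h | h
  · have h1 : r ^ m ≤ 16 * β ^ m := by
      calc r ^ m ≤ (4 * β) ^ m := by gcongr
        _ = 4 ^ m * β ^ m := mul_pow _ _ _
        _ ≤ 4 ^ 2 * β ^ m := by
          gcongr
          norm_num
        _ = _ := by norm_num
    calc r ^ m * ‖invSymbol z k‖ ≤ 16 * β ^ m * ‖invSymbol z k‖ := by gcongr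
      _ = β ^ m * (16 * ‖invSymbol z k‖ + 0) := by ring
      _ ≤ _ := by
        gcongr
        positivity
  · have hrpos : 0 < r := by linarith
    have h1 : r ^ 2 / 2 ≤ ‖symbol z ((2 * Real.pi) • k)‖ := by
      refine le_trans ?_ (symbol_norm_lower_bounds z k).1
      rw [← hr, ← hβ]
      nlinarith
    have h2 : ‖invSymbol z k‖ ≤ 2 / r ^ 2 := by
      rw [invSymbol, norm_inv, ← inv_div]
      exact inv_anti₀ (by positivity) h1
    have h3 : r ^ m * R ^ 2 ≤ β ^ m * r ^ 2 := by
      have hRβ : R ^ 2 ≤ β ^ 2 := by gcongr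
      have hβr : β ≤ r := by linarith
      calc r ^ m * R ^ 2 ≤ r ^ m * β ^ 2 := by gcongr
        _ = r ^ m * (β ^ m * β ^ (2 - m)) := by rw [← pow_add, Nat.add_sub_cancel' hm]
        _ ≤ r ^ m * (β ^ m * r ^ (2 - m)) := by gcongr
        _ = β ^ m * (r ^ m * r ^ (2 - m)) := by ring
        _ = _ := by rw [← pow_add, Nat.add_sub_cancel' hm]
    calc r ^ m * ‖invSymbol z k‖ ≤ r ^ m * (2 / r ^ 2) := by gcongr
      _ ≤ β ^ m * (2 * (R ^ 2)⁻¹) := by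
        rw [mul_div_assoc', ← div_eq_mul_inv, mul_div_assoc',
          div_le_div_iff₀ (by positivity) (by positivity)]
        nlinarith
      _ ≤ _ := by
        gcongr
        simp

/-- The imaginary part gives `|η| ≤ |P_z| + 2|a||ξ|`: the first term contributes `1 ≤ |b|² / R²`,
the second is the first-order space bound. -/
theorem time_mul_norm_invSymbol_le {n : ℕ} {R : ℝ} (hR : 0 < R) {z : Fin n → ℂ}
    (hz : R ≤ ‖imVec z‖) (k : SpaceTime n) :
    2 * Real.pi * |k.snd| * ‖invSymbol z k‖ ≤
      (2 * ‖reVec z‖ * ‖imVec z‖ + ‖imVec z‖ ^ 2) *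
        (16 * ‖invSymbol z k‖ + 2 * (R ^ 2)⁻¹) := by
  have h1 := (symbol_norm_lower_bounds z k).2
  have h2 := pow_mul_norm_invSymbol_le hR hz k (m := 1) (by norm_num)
  rw [pow_one, pow_one] at h2
  have h3 : ‖symbol z ((2 * Real.pi) • k)‖ * ‖invSymbol z k‖ ≤ 1 := by
    rw [invSymbol, norm_inv]
    exact mul_inv_le_one
  have h4 : 1 ≤ ‖imVec z‖ ^ 2 * (R ^ 2)⁻¹ := by
    rw [← div_eq_mul_inv, one_le_div (by positivity)]
    gcongr
  have h5 : 0 ≤ ‖imVec z‖ ^ 2 * (16 * ‖invSymbol z k‖) := by positivity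
  calc 2 * Real.pi * |k.snd| * ‖invSymbol z k‖
      ≤ (‖symbol z ((2 * Real.pi) • k)‖ + 2 * ‖reVec z‖ * (2 * Real.pi * ‖k.fst‖)) *
          ‖invSymbol z k‖ := by gcongr
    _ = ‖symbol z ((2 * Real.pi) • k)‖ * ‖invSymbol z k‖ +
          2 * ‖reVec z‖ * (2 * Real.pi * ‖k.fst‖ * ‖invSymbol z k‖) := by ring
    _ ≤ 1 + 2 * ‖reVec z‖ * (‖imVec z‖ * (16 * ‖invSymbol z k‖ + 2 * (R ^ 2)⁻¹)) := by gcongr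
    _ ≤ _ := by nlinarith

theorem exists_weightedNorm_solution_le_mul (n : ℕ) {δ R : ℝ} (hδ : -1 < δ) (hδ' : δ < 0)
    (hR : 0 < R) :
    ∃ C : ℝ, 0 < C ∧ ∀ z : Fin n → ℂ, imVec z ≠ 0 → R ≤ ‖imVec z‖ →
      ∀ (g φ : 𝓢(SpaceTime n, ℂ)) (S B : ℝ), 1 ≤ S → 0 ≤ B →
        (∀ k, ‖invSymbol z k‖ * ‖φ k‖ ≤
          B * (16 * ‖invSymbol z k‖ + 2 * (R ^ 2)⁻¹) * ‖𝓕 g k‖) →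
        weightedNorm δ (solution z φ) ≤
          ENNReal.ofReal (C * S * B) * weightedNorm (δ + 1) g := by
  obtain ⟨C, hC, h⟩ := exists_weightedNorm_solution_le n hδ hδ' hR
  refine ⟨16 * C + 2 * (R ^ 2)⁻¹, by positivity, fun z hz hzR g φ S B hS hB hdom => ?_⟩
  refine (h z hz hzR g φ (B * 16) (B * (2 * (R ^ 2)⁻¹)) (by positivity) (by positivity)
    fun k => (hdom k).trans_eq (by ring)).trans ?_
  gcongr
  have : 0 ≤ (16 * C + 2 * (R ^ 2)⁻¹) * B := by positivity
  nlinarith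

theorem one_le_shearFactor (a : ℝ) (ha : 0 ≤ a) : 1 ≤ √(1 + a ^ 2) + a := by
  have : 1 ≤ √(1 + a ^ 2) := Real.one_le_sqrt.2 (by nlinarith [sq_nonneg a])
  linarith

/-! ### Extension to the weighted `L²` space -/

section Extension

theorem weightMeasure_absolutelyContinuous (n : ℕ) (s : ℝ) :
    weightMeasure n s ≪ (volume : Measure (SpaceTime n)) :=
  withDensity_absolutelyContinuous _ _

theorem absolutelyContinuous_weightMeasure (n : ℕ) (s : ℝ) :
    (volume : Measure (SpaceTime n)) ≪ weightMeasure n s := by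
  refine withDensity_absolutelyContinuous' (Measurable.aemeasurable (by fun_prop))
    (Filter.Eventually.of_forall fun p => ?_)
  exact (ENNReal.ofReal_pos.2 (Real.rpow_pos_of_pos (weight_pos p) s)).ne'

instance isFiniteMeasureOnCompacts_weightMeasure (n : ℕ) (s : ℝ) :
    IsFiniteMeasureOnCompacts (weightMeasure n s) := by
  have hc : Continuous fun p : SpaceTime n => (1 + ‖p.fst‖ ^ 2 + p.snd ^ 2) ^ s :=
    (contDiff_weight_rpow n s).continuous
  have : IsLocallyFiniteMeasure (weightMeasure n s) :=
    IsLocallyFiniteMeasure.withDensity_ofReal hc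
  infer_instance

/-- Schwartz functions are dense in the weighted space, so the bound gives existence and uniqueness.
The weight is positive, so almost everywhere means the same for `volume` and for `weightMeasure`. -/
theorem existsUnique_extension {n : ℕ} {s t : ℝ}
    (A : 𝓢(SpaceTime n, ℂ) →ₗ[ℂ] SpaceTime n → ℂ) (hA : ∀ g, Continuous (A g)) {K : ℝ}
    (hK : 0 ≤ K) (hle : ∀ g, weightedNorm t (A g) ≤ ENNReal.ofReal K * weightedNorm s g) :
    ∃! T : WeightedL2 n s →L[ℂ] WeightedL2 n t, ∀ g : 𝓢(SpaceTime n, ℂ),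
      T (g.toLp 2 (weightMeasure n s)) =ᵐ[volume] A g := by
  have hfin : ∀ g : 𝓢(SpaceTime n, ℂ), weightedNorm s g ≠ ⊤ := fun g => by
    rw [weightedNorm_eq]
    exact (g.memLp 2 (weightMeasure n s)).eLpNorm_ne_top
  have hmem : ∀ g, MemLp (A g) 2 (weightMeasure n t) := fun g => by
    refine ⟨(hA g).aestronglyMeasurable, ?_⟩
    rw [← weightedNorm_eq]
    exact (hle g).trans_lt (ENNReal.mul_lt_top ENNReal.ofReal_lt_top (hfin g).lt_top)
  let F : 𝓢(SpaceTime n, ℂ) →ₗ[ℂ] WeightedL2 n t :=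
    { toFun := fun g => (hmem g).toLp (A g)
      map_add' := fun g h => by
        rw [← MemLp.toLp_add]
        exact MemLp.toLp_congr _ _ (by rw [map_add])
      map_smul' := fun c g => by
        rw [RingHom.id_apply, ← MemLp.toLp_const_smul]
        exact MemLp.toLp_congr _ _ (by rw [map_smul]) }
  let E : 𝓢(SpaceTime n, ℂ) →ₗ[ℂ] WeightedL2 n s :=
    (SchwartzMap.toLpCLM ℂ ℂ 2 (weightMeasure n s)).toLinearMap
  have hE : DenseRange E := SchwartzMap.denseRange_toLpCLM (F := ℂ) (by norm_num)
  have hFE : ∀ g, ‖F g‖ ≤ K * ‖E g‖ := fun g => by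
    change ‖(hmem g).toLp (A g)‖ ≤ K * ‖g.toLp 2 (weightMeasure n s)‖
    rw [Lp.norm_toLp, SchwartzMap.norm_toLp, ← weightedNorm_eq, ← weightedNorm_eq]
    refine (ENNReal.toReal_mono (ENNReal.mul_ne_top ENNReal.ofReal_ne_top (hfin g))
      (hle g)).trans_eq ?_
    rw [ENNReal.toReal_mul, ENNReal.toReal_ofReal hK]
  have hF : ∀ g, (F g : SpaceTime n → ℂ) =ᵐ[weightMeasure n t] A g := fun g =>
    (hmem g).coeFn_toLp
  refine ⟨F.extendOfNorm E, fun g => ?_, fun T hT => ?_⟩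
  · have h : F.extendOfNorm E (g.toLp 2 (weightMeasure n s)) = F g :=
      LinearMap.extendOfNorm_eq hE ⟨K, hFE⟩ g
    rw [h]
    exact (absolutelyContinuous_weightMeasure n t).ae_eq (hF g)
  · refine (LinearMap.extendOfNorm_unique hE K hFE T ?_).symm
    ext1 g
    exact Lp.ext (((weightMeasure_absolutelyContinuous n t).ae_eq (hT g)).trans (hF g).symm)

/-- Convolution with a tempered distribution as a linear map. -/
noncomputable def convLinear {n : ℕ} (u : 𝓢'(SpaceTime n, ℂ)) :
    𝓢(SpaceTime n, ℂ) →ₗ[ℂ] SpaceTime n → ℂ where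
  toFun := conv u
  map_add' g h := by
    ext p
    simp [conv, reflectTranslate]
  map_smul' c g := by
    ext p
    simp [conv, reflectTranslate]

end Extension

end BackwardHeat

open BackwardHeat
-- Assembly of the theorem
theorem theorem3p1 (n : ℕ) (δ R : ℝ) (hδ : -1 < δ) (hδ' : δ < 0) (hR : 0 < R) :
    ∃ C : ℝ, 0 < C ∧
      ∀ (z : Fin n → ℂ) (hz : imVec z ≠ 0), R ≤ ‖imVec z‖ →
        (∀ g : 𝓢(SpaceTime n, ℂ),
          ContDiff ℝ ∞ (conv (fundamentalSolution z hz) g) ∧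
          (∀ α : Fin n → ℕ, ∑ j, α j ≤ 2 →
            weightedNorm δ (derivX α (conv (fundamentalSolution z hz) g)) ≤
              ENNReal.ofReal (C * (√(1 + ‖reVec z‖ ^ 2) + ‖reVec z‖) *
                ‖imVec z‖ ^ (∑ j, α j)) * weightedNorm (δ + 1) g) ∧
          weightedNorm δ (partialT (conv (fundamentalSolution z hz) g)) ≤
            ENNReal.ofReal (C * (√(1 + ‖reVec z‖ ^ 2) + ‖reVec z‖) *
              (2 * ‖reVec z‖ * ‖imVec z‖ + ‖imVec z‖ ^ 2)) * weightedNorm (δ + 1) g) ∧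
        ∃! T : WeightedL2 n (δ + 1) →L[ℂ] WeightedL2 n δ,
          ∀ g : 𝓢(SpaceTime n, ℂ),
            T (g.toLp 2 (weightMeasure n (δ + 1))) =ᵐ[volume]
              conv (fundamentalSolution z hz) g := by
  obtain ⟨C, hC, hmain⟩ := exists_weightedNorm_solution_le_mul n hδ hδ' hR
  refine ⟨C, hC, fun z hz hzR => ?_⟩
  have hS := one_le_shearFactor ‖reVec z‖ (norm_nonneg _)
  have hX : ∀ (g : 𝓢(SpaceTime n, ℂ)) (α : Fin n → ℕ), ∑ j, α j ≤ 2 →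
      weightedNorm δ (derivX α (conv (fundamentalSolution z hz) g)) ≤
        ENNReal.ofReal (C * (√(1 + ‖reVec z‖ ^ 2) + ‖reVec z‖) *
          ‖imVec z‖ ^ (∑ j, α j)) * weightedNorm (δ + 1) g := by
    intro g α hα
    obtain ⟨φ, hφ, hle⟩ := exists_derivX_solution hz (𝓕 g) α
    rw [conv_fundamentalSolution, hφ]
    refine hmain z hz hzR g φ _ _ hS (by positivity) fun k => ?_
    calc ‖invSymbol z k‖ * ‖φ k‖
        ≤ ‖invSymbol z k‖ * ((2 * Real.pi * ‖k.fst‖) ^ (∑ j, α j) * ‖𝓕 g k‖) := by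
          gcongr
          exact hle k
      _ = (2 * Real.pi * ‖k.fst‖) ^ (∑ j, α j) * ‖invSymbol z k‖ * ‖𝓕 g k‖ := by ring
      _ ≤ _ := by
          exact mul_le_mul_of_nonneg_right (pow_mul_norm_invSymbol_le hR hzR k hα) (norm_nonneg _)
  refine ⟨fun g => ⟨?_, hX g, ?_⟩, ?_⟩
  · rw [conv_fundamentalSolution]
    exact contDiff_solution hz _
  · rw [conv_fundamentalSolution, partialT_solution hz]
    refine hmain z hz hzR g _ _ _ hS (by positivity) fun k => ?_
    rw [norm_mulDir_apply, inner_timeDir]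
    calc ‖invSymbol z k‖ * (2 * Real.pi * |k.snd| * ‖𝓕 g k‖)
        = 2 * Real.pi * |k.snd| * ‖invSymbol z k‖ * ‖𝓕 g k‖ := by ring
      _ ≤ _ := by
          exact mul_le_mul_of_nonneg_right (time_mul_norm_invSymbol_le hR hzR k) (norm_nonneg _)
  · refine existsUnique_extension (convLinear (fundamentalSolution z hz)) (fun g => ?_)
      (K := C * (√(1 + ‖reVec z‖ ^ 2) + ‖reVec z‖)) (by positivity) fun g => ?_
    · change Continuous (conv (fundamentalSolution z hz) g)
      rw [conv_fundamentalSolution]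
      exact (contDiff_solution hz _).continuous
    · have h := hX g 0 (by simp)
      have e : derivX 0 (conv (fundamentalSolution z hz) g) =
          conv (fundamentalSolution z hz) g := by
        unfold derivX
        simp
      rw [e] at h
      change weightedNorm δ (conv (fundamentalSolution z hz) g) ≤ _
      simpa using h
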